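/- Let $n\ge 2$. Identify $\mathrm U(n)/\mathrm O(n)$ with the set of symmetric unitary $n\times n$ matrices $T$ (so that $u\in \mathrm U(n)$ corresponds to $T=uu^t$), and let $$X=\{(T,s):\ T=T^t,\ TT^*=1,\ s\in\mathbb C,\ s^2=\det T\}$$ be its double cover. The group $\mathrm U(n)$ acts on functions on $X$ by $(\rho(u)f)(T,s)=f(u^tTu,\ \det(u)\,s)$. Irreducible finite-dimensional continuous representations of $\mathrm U(n)$ are labelled by their signatures (highest weights) $m_1\ge\dots\ge m_n$, $m_j\in\mathbb Z$. Call a function $f$ on $X$ a *solution* if it extends to a holomorphic function on the double cover $\{(T,s): T\in U,\ s^2=\det T\}$ of a neighbourhood $U$ of the set of symmetric unitary matrices in $\{T\in\mathrm{Symm}(n,\mathbb C):\det T\neq 0\}$, and the (locally defined) function $\det(T)^{-1/2}f(T)$, i.e. $s^{-1}f(T,s)$, is annihilated by all $3\times3$ minors of the $n\times n$ matrix of differential operators whose $(i,j)$ entry is $\partial/\partial t_{ij}$ for $i\ne j$ and $2\,\partial/\partial t_{ii}$ for $i=j$. For symmetric unitary $S$ and $\sigma\in\mathbb C^n$ with $\sigma=-S\bar\sigma$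 put $L_{S,\sigma}=\{h\in\mathbb C^n: h=S\bar h+\sigma\}$; these are the affine Lagrangian subspaces of $\mathbb C^n=\mathbb R^{2n}$. For a Schwartz function $\varphi$ on $\mathbb C^n$ its Radon transform is $\mathcal R_{comp}\varphi(S,\sigma)=\int_{L_{S,\sigma}}\varphi\,d\mu$, where $\mu$ is the Euclidean surface measure on $L_{S,\sigma}$. The compact determinantal system for a function $g$ of $(S,s,\sigma)$, $(S,s)\in X$, $\sigma=-S\bar\sigma$, requires that $g$ have a holomorphic extension $G$ to a neighbourhood (in the double cover defined by $s^2=\det S\neq 0$ of $\mathrm{Symm}(n,\mathbb C)\times\mathbb C^n$) and that $\det(S)^{-1/2}G(S,\sigma)$ be annihilated by all $3\times 3$ minors of the $(n+1)\times(n+1)$ matrix obtained from the above one (with $t_{ij}$ replaced by the entries of $S$) by adding a last row and column with entries $\partial/\partial\sigma_i$ and corner entry $0$. Then: 1. A function $f$ on $X$ is a solution if and only if the function $(S,s,\sigma)\mapsto f(S,s)$ satisfies the compact determinantal system. 2. For each of the following signatures the space of solutions contains an irreducible $\mathrm U(n)$-subrepresentation with this signature: $$(2\alpha+1,\,2\beta+1,\,1,\dots,1)\quad(\alpha\ge\beta\ge0),$$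 $$(2\alpha,\,0,\dots,0,\,-2\gamma)\quad(\alpha\ge0,\ \gamma\ge0),$$ $$(-1,\dots,-1,\,-2\gamma-1,\,-2\delta-1)\quad(\delta\ge\gamma\ge0),$$ where $\alpha,\beta,\gamma,\delta$ are integers. 3. For no nonzero $f$ in these subrepresentations is the function $(S,s,\sigma)\mapsto f(S,s)$ the Radon transform of a Schwartz function, i.e. of the form $\mathcal R_{comp}\varphi(S,\sigma)$. -/

import Mathlib

open scoped Matrix SchwartzMap

noncomputable section

namespace Extraneous

/-! ### Symmetric matrices and the matrix of partial derivatives -/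

/-- The independent complex coordinates `t_{ij}`, `i ≤ j`, on the space `Symm(n, ℂ)` of symmetric
matrices, indexed by unordered pairs. -/
abbrev SymCoord (n : ℕ) : Type := Sym2 (Fin n) → ℂ

/-- The symmetric matrix with given coordinates. -/
def toMat {n : ℕ} (t : SymCoord n) : Matrix (Fin n) (Fin n) ℂ :=
  Matrix.of fun i j => t s(i, j)

/-- The derivative of `F` in the direction `v`, as a function of the point. -/
def dirDeriv {E : Type*} [NormedAddCommGroup E] [NormedSpace ℂ E] (v : E) (F : E → ℂ) : E → ℂ :=
  fun x => fderiv ℂ F x v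

/-- Let `v` be a matrix of vectors, thought of as the matrix of the first order operators
`∂_{v i j}`. This is its `3 × 3` minor with rows `I` and columns `J`, applied to `F`. -/
def minorOp {E : Type*} [NormedAddCommGroup E] [NormedSpace ℂ E] {ι : Type*} (v : ι → ι → E)
    (I J : Fin 3 ↪ ι) (F : E → ℂ) : E → ℂ :=
  fun x => ∑ p : Equiv.Perm (Fin 3), ((Equiv.Perm.sign p : ℤ) : ℂ) *
    dirDeriv (v (I (p 0)) (J 0)) (dirDeriv (v (I (p 1)) (J 1))
      (dirDeriv (v (I (p 2)) (J 2)) F)) x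

/-- The directions of the `n × n` matrix of operators with entries `2 ∂/∂t_{ii}` on the diagonal
and `∂/∂t_{ij}` off the diagonal. -/
def symDir {n : ℕ} (i j : Fin n) : SymCoord n :=
  Pi.single s(i, j) (if i = j then 2 else 1)

/-- The directions of the bordered `(n + 1) × (n + 1)` matrix of operators on
`Symm(n, ℂ) × ℂⁿ`: the matrix of `symDir` with the extra row and column `∂/∂τ_i` and corner `0`
(the extra index is `none`). -/
def borderDir {n : ℕ} : Option (Fin n) → Option (Fin n) → SymCoord n × (Fin n → ℂ)
  | some i, some j => (symDir i j, 0)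
  | some i, none => (0, Pi.single i 1)
  | none, some j => (0, Pi.single j 1)
  | none, none => 0

/-! ### The double cover of `U(n)/O(n)` -/

/-- The double cover of the Lagrangian Grassmannian `U(n)/O(n)`. The latter is the set of symmetric
unitary matrices `T = u uᵗ`; the cover adds a choice `s` of a square root of `det T`. -/
@[ext]
structure LagCover (n : ℕ) where
  T : Matrix (Fin n) (Fin n) ℂ
  s : ℂ
  unitary : T ∈ Matrix.unitaryGroup (Fin n) ℂ
  symm : Tᵀ = T
  sq : s ^ 2 = T.det

theorem transpose_mem_unitaryGroup {n : ℕ} {A : Matrix (Fin n) (Fin n) ℂ}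
    (h : A ∈ Matrix.unitaryGroup (Fin n) ℂ) : Aᵀ ∈ Matrix.unitaryGroup (Fin n) ℂ := by
  rw [Matrix.mem_unitaryGroup_iff'] at h
  rw [Matrix.mem_unitaryGroup_iff]
  have := congrArg Matrix.transpose h
  rw [Matrix.transpose_mul, Matrix.transpose_one] at this
  exact this

/-- The substitution `T ↦ uᵗ T u`, lifted to the double cover. -/
def LagCover.act {n : ℕ} (u : Matrix.unitaryGroup (Fin n) ℂ) (x : LagCover n) : LagCover n where
  T := (u : Matrix (Fin n) (Fin n) ℂ)ᵀ * x.T * (u : Matrix (Fin n) (Fin n) ℂ)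
  s := (u : Matrix (Fin n) (Fin n) ℂ).det * x.s
  unitary := mul_mem (mul_mem (transpose_mem_unitaryGroup u.2) x.unitary) u.2
  symm := by
    simp only [Matrix.transpose_mul, Matrix.transpose_transpose, x.symm, Matrix.mul_assoc]
  sq := by
    rw [mul_pow, x.sq, Matrix.det_mul, Matrix.det_mul, Matrix.det_transpose]
    ring

/-- The representation of `U(n)` on functions on the double cover of `U(n)/O(n)`,
`(ρ(u) f)(T) = f(uᵗ T u)`. -/
def coverRep (n : ℕ) : Representation ℂ (Matrix.unitaryGroup (Fin n) ℂ) (LagCover n → ℂ) where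
  toFun u :=
    { toFun := fun f x => f (x.act u)
      map_add' := fun _ _ => rfl
      map_smul' := fun _ _ => rfl }
  map_one' := by
    ext f x
    have h : x.act 1 = x := by ext <;> simp [LagCover.act]
    simp [h]
  map_mul' u v := by
    ext f x
    have h : x.act (u * v) = (x.act u).act v := by
      ext1
      · simp [LagCover.act, Matrix.mul_assoc]
      · simp [LagCover.act, Matrix.det_mul]; ring
    simp [h]

/-! ### Signatures of irreducible representations of `U(n)` -/

/-- The diagonal unitary matrix with entries `z`. -/
def diagU {n : ℕ} (z : Fin n → Circle) : Matrix.unitaryGroup (Fin n) ℂ :=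
  ⟨Matrix.diagonal fun i => (z i : ℂ), by
    rw [Matrix.mem_unitaryGroup_iff, Matrix.star_eq_conjTranspose, Matrix.diagonal_conjTranspose,
      Matrix.diagonal_mul_diagonal, ← Matrix.diagonal_one]
    congr 1
    ext i
    simp [Complex.mul_conj, Complex.normSq_eq_norm_sq, Circle.norm_coe]⟩

/-- `μ` is a weight of `ρ` for the diagonal torus. -/
def IsWeight {n : ℕ} {V : Type*} [AddCommGroup V] [Module ℂ V]
    (ρ : Representation ℂ (Matrix.unitaryGroup (Fin n) ℂ) V) (μ : Fin n → ℤ) : Prop :=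
  ∃ v : V, v ≠ 0 ∧ ∀ z : Fin n → Circle, ρ (diagU z) v = (∏ i, (z i : ℂ) ^ μ i) • v

/-- The dominance order of weights: `m - μ` is a combination with nonnegative integer coefficients
of the simple roots `e_i - e_{i+1}`. -/
def WeightLE {n : ℕ} (μ m : Fin n → ℤ) : Prop :=
  (∀ k : ℕ, ∑ i with i.val < k, μ i ≤ ∑ i with i.val < k, m i) ∧ ∑ i, μ i = ∑ i, m i

/-- `ρ` is (a copy of) the finite-dimensional continuous irreducible representation of `U(n)` with
signature `m₁ ≥ … ≥ mₙ`, that is, with highest weight `m`. -/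
structure HasSignature {n : ℕ} {V : Type*} [AddCommGroup V] [Module ℂ V]
    (ρ : Representation ℂ (Matrix.unitaryGroup (Fin n) ℂ) V) (m : Fin n → ℤ) : Prop where
  dominant : Antitone m
  finite : FiniteDimensional ℂ V
  continuous : ∀ (v : V) (φ : Module.Dual ℂ V), Continuous fun u => φ (ρ u v)
  irreducible : ρ.IsIrreducible
  isWeight : IsWeight ρ m
  highest : ∀ μ, IsWeight ρ μ → WeightLE μ m

/-! ### The determinantal systems -/

/-- `f` is a real analytic solution on the double cover of `U(n)/O(n)` of the system given by the
`3 × 3` minors of the `n × n` matrix of derivatives applied to `det(T)^{-1/2} f(T)`.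

`U` is a neighbourhood of the symmetric unitary matrices in `Symm(n, ℂ)` and `F` is the holomorphic
extension of `f` to the double cover `{(t, s) | t ∈ U, s² = det t}`. The local charts of this cover
are the graphs of the holomorphic branches `r` of `√det`; holomorphy of `F` and the differential
equations are expressed in these charts. -/
def IsDeltaSolution {n : ℕ} (f : LagCover n → ℂ) : Prop :=
  ∃ (U : Set (SymCoord n)) (F : SymCoord n → ℂ → ℂ),
    IsOpen U ∧ (∀ t ∈ U, (toMat t).det ≠ 0) ∧
    (∀ (x : LagCover n) (t : SymCoord n), toMat t = x.T → t ∈ U ∧ F t x.s = f x) ∧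
    ∀ (W : Set (SymCoord n)) (r : SymCoord n → ℂ), IsOpen W → W ⊆ U → AnalyticOnNhd ℂ r W →
      (∀ t ∈ W, r t ^ 2 = (toMat t).det) →
      AnalyticOnNhd ℂ (fun t => F t (r t)) W ∧
      ∀ (I J : Fin 3 ↪ Fin n), ∀ t ∈ W,
        minorOp symDir I J (fun t => (r t)⁻¹ * F t (r t)) t = 0

/-- The double cover of the affine Lagrangian Grassmannian in its compact coordinates `(S, σ)`:
`S` is symmetric unitary (with a chosen square root of `det S`) and `σ = - S σ̄`. -/
def AffLagCover (n : ℕ) : Type :=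
  {p : LagCover n × (Fin n → ℂ) // p.2 = -(p.1.T *ᵥ star p.2)}

/-- `g` is a real analytic solution of the compact determinantal system on (the double cover of)
the affine Lagrangian Grassmannian: `det(S)^{-1/2} G(S, σ)`, with `G` the holomorphic extension of
`g`, is annihilated by the `3 × 3` minors of the bordered matrix of derivatives. The conventions
are those of `IsDeltaSolution`. -/
def IsCompSolution {n : ℕ} (g : AffLagCover n → ℂ) : Prop :=
  ∃ (O : Set (SymCoord n × (Fin n → ℂ))) (G : SymCoord n → ℂ → (Fin n → ℂ) → ℂ),
    IsOpen O ∧ (∀ p ∈ O, (toMat p.1).det ≠ 0) ∧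
    (∀ (q : AffLagCover n) (t : SymCoord n), toMat t = q.1.1.T →
      (t, q.1.2) ∈ O ∧ G t q.1.1.s q.1.2 = g q) ∧
    ∀ (W : Set (SymCoord n)) (r : SymCoord n → ℂ), IsOpen W → AnalyticOnNhd ℂ r W →
      (∀ t ∈ W, r t ^ 2 = (toMat t).det) →
      AnalyticOnNhd ℂ (fun p => G p.1 (r p.1) p.2 : SymCoord n × (Fin n → ℂ) → ℂ)
        (O ∩ Prod.fst ⁻¹' W) ∧
      ∀ (I J : Fin 3 ↪ Option (Fin n)), ∀ p ∈ O ∩ Prod.fst ⁻¹' W,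
        minorOp borderDir I J
          (fun p : SymCoord n × (Fin n → ℂ) => (r p.1)⁻¹ * G p.1 (r p.1) p.2) p = 0

/-- The function on the affine Lagrangian Grassmannian that is constant on the fibres `S = const`
and is given by `f`. -/
def constOnFibres {n : ℕ} (f : LagCover n → ℂ) : AffLagCover n → ℂ := fun q => f q.1.1

/-! ### The Lagrangian Radon transform -/

/-- The linear Lagrangian subspace `{h | h = S h̄}` of `ℂⁿ = ℝ²ⁿ`. -/
def lagDir {n : ℕ} (S : Matrix (Fin n) (Fin n) ℂ) : Submodule ℝ (EuclideanSpace ℂ (Fin n)) where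
  carrier := {h | h.ofLp = S *ᵥ star h.ofLp}
  zero_mem' := by simp
  add_mem' := by
    intro a b ha hb
    simp only [Set.mem_ofPred_eq] at ha hb ⊢
    rw [WithLp.ofLp_add, star_add, Matrix.mulVec_add, ← ha, ← hb]
  smul_mem' := by
    intro c a ha
    simp only [Set.mem_ofPred_eq] at ha ⊢
    rw [WithLp.ofLp_smul, star_smul, Matrix.mulVec_smul, star_trivial, ← ha]

/-- The Lagrangian Radon transform: the integral of `φ` over the affine Lagrangian subspace
`L = {h | h = S h̄ + σ} = σ/2 + {h | h = S h̄}` of `ℂⁿ = ℝ²ⁿ` with respect to the Euclidean surface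
measure of `L`. -/
def radonComp {n : ℕ} (φ : 𝓢(EuclideanSpace ℂ (Fin n), ℂ)) (S : Matrix (Fin n) (Fin n) ℂ)
    (σ : Fin n → ℂ) : ℂ :=
  ∫ w : lagDir S, φ (WithLp.toLp 2 ((1 / 2 : ℂ) • σ) + (w : EuclideanSpace ℂ (Fin n)))

/-- `g` is (the pullback to the double cover of) the Radon transform of a Schwartz function. -/
def IsRadonTransform {n : ℕ} (g : AffLagCover n → ℂ) : Prop :=
  ∃ φ : 𝓢(EuclideanSpace ℂ (Fin n), ℂ), ∀ q : AffLagCover n, g q = radonComp φ q.1.1.T q.1.2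

/-- The irreducible representation of `U(n)` with signature `m` is contained in the space of
solutions on the double cover of `U(n)/O(n)`, and no nonzero solution in it (considered as a
function constant on the fibres) is a Radon transform. -/
def ContainsExtraneous (n : ℕ) (m : Fin n → ℤ) : Prop :=
  ∃ V : Subrepresentation (coverRep n), HasSignature V.toRepresentation m ∧
    (∀ f ∈ V, IsDeltaSolution f) ∧
    ∀ f ∈ V, f ≠ 0 → ¬ IsRadonTransform (constOnFibres f)

/-- `(2α + 1, 2β + 1, 1, …, 1)` -/
def sigPos (n α β : ℕ) : Fin n → ℤ := fun i =>
  if i.val = 0 then 2 * α + 1 else if i.val = 1 then 2 * β + 1 else 1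

/-- `(2α, 0, …, 0, -2γ)` -/
def sigMixed (n α γ : ℕ) : Fin n → ℤ := fun i =>
  if i.val = 0 then 2 * α else if i.val + 1 = n then -(2 * γ) else 0

/-- `(-1, …, -1, -2γ - 1, -2δ - 1)` -/
def sigNeg (n γ δ : ℕ) : Fin n → ℤ := fun i =>
  if i.val + 1 = n then -(2 * δ) - 1 else if i.val + 2 = n then -(2 * γ) - 1 else -1

end Extraneous

end

/-! The system is solved by products. If `P` and `Q` are both annihilated by the 2×2 minors of the
operator matrix, Leibniz makes that matrix act on `P * Q` as the sum of two rank one matrices, so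
every 3×3 minor kills the product (`RankOneOn.minorOp_mul`). Two families of such rank one functions
are used: `(xᵗTx)^e`, and `det(T)^{-1/2} (yᵗT⁻¹y)^e`. Products of two of them, multiplied by `s`,
give solutions of three types, with prefactor `s`, `1` or `s⁻¹`. For `s` and `s⁻¹`, polarization in
a parameter `p` turns products of powers of quadratic forms into powers of 2×2 minors of `T` or
`T⁻¹`.

The three series are generated by explicit highest weight functions: `s` times powers of the first
entry and the leading 2×2 minor of `T`; a power of the first entry of `T` times a power of the last
entry of `T⁻¹`; and `s⁻¹` times powers of the last entry and the last 2×2 minor of `T⁻¹`.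
Translating by `u` replaces basis vectors by columns of `u` or its conjugate, so all translates are
solutions.

Irreducibility is proved by integration over `U(n)`. Every translate of the generator `h` is a
multiple of `h` plus terms of lower weight. If an invariant subspace `W` of the span does not
contain `h`, then all translates of any `F ∈ W` have only lower weights and are orthogonal to `h` on
every orbit; by invariance `F` is orthogonal to all translates of `h`, hence to itself, and vanishes
(`mem_of_invariant`).

The equivalence of the two systems holds because derivatives in `σ` kill functions of `S` alone, and
conversely a solution can be restricted to `σ = 0`. A Radon transform tends to zero along each
fibre, so one that is constant on the fibres is zero (`eq_zero_of_isRadonTransform_constOnFibres`).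
-/

noncomputable section

namespace Extraneous

/-! ### Directional derivatives of analytic functions -/

section DirDeriv

variable {E : Type*} [NormedAddCommGroup E] [NormedSpace ℂ E] {W : Set E} {f g : E → ℂ}

theorem dirDeriv_eqOn (hW : IsOpen W) (h : Set.EqOn f g W) (v : E) :
    Set.EqOn (dirDeriv v f) (dirDeriv v g) W := by
  intro x hx
  have : f =ᶠ[nhds x] g := by
    filter_upwards [hW.mem_nhds hx] with y hy using h hy
  simp only [dirDeriv, this.fderiv_eq]

theorem dirDeriv_analytic (hf : AnalyticOnNhd ℂ f W) (v : E) :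
    AnalyticOnNhd ℂ (dirDeriv v f) W :=
  (ContinuousLinearMap.apply ℂ ℂ v).comp_analyticOnNhd hf.fderiv

theorem dirDeriv_add (hf : AnalyticOnNhd ℂ f W) (hg : AnalyticOnNhd ℂ g W) (v : E) :
    Set.EqOn (dirDeriv v (f + g)) (dirDeriv v f + dirDeriv v g) W := by
  intro x hx
  simp only [dirDeriv, Pi.add_apply]
  rw [fderiv_add (hf x hx).differentiableAt (hg x hx).differentiableAt]
  rfl

theorem dirDeriv_mul (hf : AnalyticOnNhd ℂ f W) (hg : AnalyticOnNhd ℂ g W) (v : E) :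
    Set.EqOn (dirDeriv v (f * g)) (dirDeriv v f * g + f * dirDeriv v g) W := by
  intro x hx
  simp only [dirDeriv, Pi.add_apply, Pi.mul_apply]
  rw [fderiv_mul (hf x hx).differentiableAt (hg x hx).differentiableAt]
  simp
  ring

theorem dirDeriv_const_smul (c : ℂ) (v : E) : dirDeriv v (c • f) = c • dirDeriv v f := by
  funext x
  simp [dirDeriv, fderiv_const_smul_field]

theorem dirDeriv_comm (hf : AnalyticOnNhd ℂ f W) (v w : E) :
    Set.EqOn (dirDeriv v (dirDeriv w f)) (dirDeriv w (dirDeriv v f)) W := by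
  intro x hx
  have key : ∀ a b : E, dirDeriv a (dirDeriv b f) x = fderiv ℂ (fderiv ℂ f) x a b := by
    intro a b
    have h := (hf.fderiv x hx).differentiableAt
    have := fderiv_clm_apply (𝕜 := ℂ) (x := x) h (differentiableAt_const b)
    change fderiv ℂ (fun y => fderiv ℂ f y b) x a = _
    rw [this]
    simp
  rw [key, key]
  exact ((hf x hx).contDiffAt (n := 2)).isSymmSndFDerivAt (by simp) v w

/-- Writing out the six terms lets the cancellation in `RankOneOn.minorOp_mul` be left to `ring`. -/
theorem sum_sign_perm_three (d : Fin 3 → Fin 3 → Fin 3 → ℂ) :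
    ∑ p : Equiv.Perm (Fin 3), ((Equiv.Perm.sign p : ℤ) : ℂ) * d (p 0) (p 1) (p 2) =
      d 0 1 2 - d 1 0 2 - d 0 2 1 - d 2 1 0 + d 1 2 0 + d 2 0 1 := by
  have : (Finset.univ : Finset (Equiv.Perm (Fin 3))) =
      {1, Equiv.swap 0 1, Equiv.swap 1 2, Equiv.swap 0 2,
        Equiv.swap 0 1 * Equiv.swap 1 2, Equiv.swap 1 2 * Equiv.swap 0 1} := by decide
  rw [this, Finset.sum_insert (by decide), Finset.sum_insert (by decide),
    Finset.sum_insert (by decide), Finset.sum_insert (by decide), Finset.sum_insert (by decide),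
    Finset.sum_singleton]
  have h01 : (Equiv.Perm.sign (Equiv.swap (0 : Fin 3) 1) : ℤ) = -1 := by decide
  have h12 : (Equiv.Perm.sign (Equiv.swap (1 : Fin 3) 2) : ℤ) = -1 := by decide
  have h02 : (Equiv.Perm.sign (Equiv.swap (0 : Fin 3) 2) : ℤ) = -1 := by decide
  have h3 : (Equiv.Perm.sign (Equiv.swap (0 : Fin 3) 1 * Equiv.swap 1 2) : ℤ) = 1 := by decide
  have h4 : (Equiv.Perm.sign (Equiv.swap (1 : Fin 3) 2 * Equiv.swap 0 1) : ℤ) = 1 := by decide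
  rw [h01, h12, h02, h3, h4]
  have e1 : (Equiv.swap (0 : Fin 3) 1 * Equiv.swap 1 2 : Equiv.Perm (Fin 3)) 0 = 1 := by decide
  have e2 : (Equiv.swap (0 : Fin 3) 1 * Equiv.swap 1 2 : Equiv.Perm (Fin 3)) 1 = 2 := by decide
  have e3 : (Equiv.swap (0 : Fin 3) 1 * Equiv.swap 1 2 : Equiv.Perm (Fin 3)) 2 = 0 := by decide
  have e4 : (Equiv.swap (1 : Fin 3) 2 * Equiv.swap 0 1 : Equiv.Perm (Fin 3)) 0 = 2 := by decide
  have e5 : (Equiv.swap (1 : Fin 3) 2 * Equiv.swap 0 1 : Equiv.Perm (Fin 3)) 1 = 0 := by decide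
  have e6 : (Equiv.swap (1 : Fin 3) 2 * Equiv.swap 0 1 : Equiv.Perm (Fin 3)) 2 = 1 := by decide
  have e7 : Equiv.swap (0 : Fin 3) 1 2 = 2 := by decide
  have e8 : Equiv.swap (1 : Fin 3) 2 0 = 0 := by decide
  have e9 : Equiv.swap (0 : Fin 3) 2 1 = 1 := by decide
  rw [e1, e2, e3, e4, e5, e6, e7, e8, e9]
  simp only [Equiv.Perm.coe_one, id_eq, Equiv.swap_apply_left, Equiv.swap_apply_right,
    Equiv.Perm.sign_one, Units.val_one, Int.cast_one, Int.cast_neg]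
  ring

theorem minorOp_eqOn {ι : Type*} (v : ι → ι → E) (I J : Fin 3 ↪ ι) (hW : IsOpen W)
    (h : Set.EqOn f g W) : Set.EqOn (minorOp v I J f) (minorOp v I J g) W := by
  intro x hx
  simp only [minorOp]
  refine Finset.sum_congr rfl fun p _ => ?_
  rw [dirDeriv_eqOn hW (dirDeriv_eqOn hW (dirDeriv_eqOn hW h _) _) _ hx]

theorem minorOp_add {ι : Type*} (v : ι → ι → E) (I J : Fin 3 ↪ ι) (hW : IsOpen W)
    (hf : AnalyticOnNhd ℂ f W) (hg : AnalyticOnNhd ℂ g W) :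
    Set.EqOn (minorOp v I J (f + g)) (minorOp v I J f + minorOp v I J g) W := by
  intro x hx
  simp only [minorOp, Pi.add_apply, ← Finset.sum_add_distrib, ← mul_add]
  refine Finset.sum_congr rfl fun p _ => ?_
  congr 1
  refine ((dirDeriv_eqOn hW ((dirDeriv_eqOn hW (dirDeriv_add hf hg _) _).trans
    (dirDeriv_add (dirDeriv_analytic hf _) (dirDeriv_analytic hg _) _)) _).trans
    (dirDeriv_add (dirDeriv_analytic (dirDeriv_analytic hf _) _)
      (dirDeriv_analytic (dirDeriv_analytic hg _) _) _)) hx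

theorem minorOp_smul {ι : Type*} (v : ι → ι → E) (I J : Fin 3 ↪ ι) (c : ℂ) :
    minorOp v I J (c • f) = c • minorOp v I J f := by
  funext x
  simp only [minorOp, dirDeriv_const_smul, Pi.smul_apply, smul_eq_mul, Finset.mul_sum]
  refine Finset.sum_congr rfl fun p _ => ?_
  ring

/-- `P` is analytic on `W` and annihilated by the `2 × 2` minors of the matrix of operators
`∂_{v i j}`. -/
structure RankOneOn {ι : Type*} (v : ι → ι → E) (W : Set E) (P : E → ℂ) : Prop where
  analytic : AnalyticOnNhd ℂ P W
  swap : ∀ i j k l, Set.EqOn (dirDeriv (v i j) (dirDeriv (v k l) P))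
    (dirDeriv (v k j) (dirDeriv (v i l) P)) W

namespace RankOneOn

variable {ι : Type*} {v : ι → ι → E} {P Q : E → ℂ}

theorem swap_right (hW : IsOpen W) (h : RankOneOn v W P) (w : E) (i j k l : ι) :
    Set.EqOn (dirDeriv w (dirDeriv (v i j) (dirDeriv (v k l) P)))
      (dirDeriv w (dirDeriv (v k j) (dirDeriv (v i l) P))) W :=
  dirDeriv_eqOn hW (h.swap i j k l) w

/-- Constant coefficient operators commute, so derivatives of a rank one function satisfy the same
relations. -/
theorem swap_left (hW : IsOpen W) (h : RankOneOn v W P) (w : E) (i j k l : ι) :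
    Set.EqOn (dirDeriv (v i j) (dirDeriv (v k l) (dirDeriv w P)))
      (dirDeriv (v k j) (dirDeriv (v i l) (dirDeriv w P))) W := by
  have key : ∀ a b : E, Set.EqOn (dirDeriv a (dirDeriv b (dirDeriv w P)))
      (dirDeriv w (dirDeriv a (dirDeriv b P))) W := fun a b =>
    (dirDeriv_eqOn hW (dirDeriv_comm h.analytic b w) a).trans
      (dirDeriv_comm (dirDeriv_analytic h.analytic b) a w)
  exact (key _ _).trans ((h.swap_right hW w i j k l).trans (key _ _).symm)

/-- Leibniz rule: one term for each subset of the three operators falling on `P`. -/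
theorem dirDeriv_three_mul (hW : IsOpen W) (hP : AnalyticOnNhd ℂ P W) (hQ : AnalyticOnNhd ℂ Q W)
    (a b c : E) : Set.EqOn (dirDeriv a (dirDeriv b (dirDeriv c (P * Q))))
      (dirDeriv a (dirDeriv b (dirDeriv c P)) * Q + dirDeriv b (dirDeriv c P) * dirDeriv a Q +
        dirDeriv a (dirDeriv c P) * dirDeriv b Q + dirDeriv c P * dirDeriv a (dirDeriv b Q) +
        dirDeriv a (dirDeriv b P) * dirDeriv c Q + dirDeriv b P * dirDeriv a (dirDeriv c Q) +
        dirDeriv a P * dirDeriv b (dirDeriv c Q) + P * dirDeriv a (dirDeriv b (dirDeriv c Q))) W := by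
  have A := fun (w : E) {F : E → ℂ} (hF : AnalyticOnNhd ℂ F W) => dirDeriv_analytic hF w
  have M : ∀ {F G : E → ℂ}, AnalyticOnNhd ℂ F W → AnalyticOnNhd ℂ G W →
      AnalyticOnNhd ℂ (F * G) W := fun hF hG => hF.mul hG
  have S : ∀ {F G : E → ℂ}, AnalyticOnNhd ℂ F W → AnalyticOnNhd ℂ G W →
      AnalyticOnNhd ℂ (F + G) W := fun hF hG => hF.add hG
  have two : Set.EqOn (dirDeriv b (dirDeriv c (P * Q)))
      ((dirDeriv b (dirDeriv c P) * Q + dirDeriv c P * dirDeriv b Q) +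
        (dirDeriv b P * dirDeriv c Q + P * dirDeriv b (dirDeriv c Q))) W := by
    refine (dirDeriv_eqOn hW (dirDeriv_mul hP hQ c) b).trans
      ((dirDeriv_add (M (A c hP) hQ) (M hP (A c hQ)) b).trans fun x hx => ?_)
    rw [Pi.add_apply, Pi.add_apply, dirDeriv_mul (A c hP) hQ b hx, dirDeriv_mul hP (A c hQ) b hx]
  intro x hx
  rw [dirDeriv_eqOn hW two a hx,
    dirDeriv_add (S (M (A b (A c hP)) hQ) (M (A c hP) (A b hQ)))
      (S (M (A b hP) (A c hQ)) (M hP (A b (A c hQ)))) a hx, Pi.add_apply,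
    dirDeriv_add (M (A b (A c hP)) hQ) (M (A c hP) (A b hQ)) a hx,
    dirDeriv_add (M (A b hP) (A c hQ)) (M hP (A b (A c hQ))) a hx, Pi.add_apply, Pi.add_apply,
    dirDeriv_mul (A b (A c hP)) hQ a hx, dirDeriv_mul (A c hP) (A b hQ) a hx,
    dirDeriv_mul (A b hP) (A c hQ) a hx, dirDeriv_mul hP (A b (A c hQ)) a hx]
  simp only [Pi.add_apply, Pi.mul_apply]
  ring

/-- A sum of two rank one matrices has vanishing 3×3 minors. In each Leibniz term at least two of
the three operators fall on the same factor; exchanging their rows leaves the term unchanged and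
flips the sign of the permutation. -/
theorem minorOp_mul (hW : IsOpen W) (hP : RankOneOn v W P) (hQ : RankOneOn v W Q)
    (I J : Fin 3 ↪ ι) {x : E} (hx : x ∈ W) : minorOp v I J (P * Q) x = 0 := by
  have h := sum_sign_perm_three fun a b c => dirDeriv (v (I a) (J 0))
    (dirDeriv (v (I b) (J 1)) (dirDeriv (v (I c) (J 2)) (P * Q))) x
  rw [minorOp, h]
  simp only [dirDeriv_three_mul hW hP.analytic hQ.analytic _ _ _ hx, Pi.add_apply,
    Pi.mul_apply]
  have s3 : ∀ {R : E → ℂ}, RankOneOn v W R → ∀ a b c : Fin 3,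
      dirDeriv (v (I a) (J 0)) (dirDeriv (v (I b) (J 1)) (dirDeriv (v (I c) (J 2)) R)) x =
      dirDeriv (v (I b) (J 0)) (dirDeriv (v (I a) (J 1)) (dirDeriv (v (I c) (J 2)) R)) x :=
    fun hR a b c => hR.swap_left hW _ _ _ _ _ hx
  have s2 : ∀ {R : E → ℂ}, RankOneOn v W R → ∀ a b j k : Fin 3,
      dirDeriv (v (I a) (J j)) (dirDeriv (v (I b) (J k)) R) x =
      dirDeriv (v (I b) (J j)) (dirDeriv (v (I a) (J k)) R) x :=
    fun hR a b j k => hR.swap _ _ _ _ hx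
  -- These rewrites put the rows of two operators acting on the same factor in increasing order;
  -- terms of opposite sign then coincide.
  rw [s3 hP 1 0 2, s3 hP 2 0 1, s3 hP 2 1 0, s3 hQ 1 0 2, s3 hQ 2 0 1, s3 hQ 2 1 0,
    s2 hP 1 0 0 1, s2 hP 1 0 0 2, s2 hP 1 0 1 2, s2 hP 2 0 0 1, s2 hP 2 0 0 2, s2 hP 2 0 1 2,
    s2 hP 2 1 0 1, s2 hP 2 1 0 2, s2 hP 2 1 1 2,
    s2 hQ 1 0 0 1, s2 hQ 1 0 0 2, s2 hQ 1 0 1 2, s2 hQ 2 0 0 1, s2 hQ 2 0 0 2, s2 hQ 2 0 1 2,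
    s2 hQ 2 1 0 1, s2 hQ 2 1 0 2, s2 hQ 2 1 1 2]
  ring

end RankOneOn

end DirDeriv

/-! ### Solutions that are constant along the fibres -/

section Fibres

variable {E F : Type*} [NormedAddCommGroup E] [NormedSpace ℂ E] [NormedAddCommGroup F]
  [NormedSpace ℂ F]

theorem analyticOnNhd_comp_inl {O : Set (E × F)} {H : E × F → ℂ} (hH : AnalyticOnNhd ℂ H O) :
    AnalyticOnNhd ℂ (fun t => H (t, 0)) ((fun t => (t, (0 : F))) ⁻¹' O) :=
  hH.comp (f := fun t => (t, (0 : F))) (analyticOnNhd_id.prod analyticOnNhd_const) fun _ h => h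

theorem dirDeriv_comp_inl {O : Set (E × F)} {H : E × F → ℂ} (hH : AnalyticOnNhd ℂ H O) (v : E) :
    Set.EqOn (dirDeriv v fun t => H (t, 0)) (fun t => dirDeriv (v, 0) H (t, 0))
      ((fun t => (t, (0 : F))) ⁻¹' O) := by
  intro t ht
  have h1 : HasFDerivAt H (fderiv ℂ H (t, 0)) (t, (0 : F)) :=
    (hH _ ht).differentiableAt.hasFDerivAt
  have h2 : HasFDerivAt (fun t : E => (t, (0 : F))) (ContinuousLinearMap.inl ℂ E F) t :=
    (ContinuousLinearMap.inl ℂ E F).hasFDerivAt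
  simp only [dirDeriv]
  rw [show (fun t => H (t, 0)) = H ∘ fun t => (t, (0 : F)) from rfl, (h1.comp t h2).fderiv]
  simp

theorem dirDeriv_comp_fst {W : Set E} {H : E → ℂ} (hH : AnalyticOnNhd ℂ H W) (v : E × F) :
    Set.EqOn (dirDeriv v fun p : E × F => H p.1) (fun p => dirDeriv v.1 H p.1)
      (Prod.fst ⁻¹' W) := by
  intro p hp
  have h1 : HasFDerivAt H (fderiv ℂ H p.1) p.1 := (hH _ hp).differentiableAt.hasFDerivAt
  simp only [dirDeriv]
  rw [show (fun p : E × F => H p.1) = H ∘ Prod.fst from rfl,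
    (HasFDerivAt.comp p h1 hasFDerivAt_fst).fderiv]
  simp

theorem dirDeriv_three_comp_inl {O : Set (E × F)} (hO : IsOpen O) {H : E × F → ℂ}
    (hH : AnalyticOnNhd ℂ H O) (a b c : E) :
    Set.EqOn (dirDeriv a (dirDeriv b (dirDeriv c fun t => H (t, 0))))
      (fun t => dirDeriv (a, 0) (dirDeriv (b, 0) (dirDeriv (c, 0) H)) (t, 0))
      ((fun t => (t, (0 : F))) ⁻¹' O) := by
  have hW : IsOpen ((fun t : E => (t, (0 : F))) ⁻¹' O) := hO.preimage (by fun_prop)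
  exact (dirDeriv_eqOn hW ((dirDeriv_eqOn hW (dirDeriv_comp_inl hH c) b).trans
    (dirDeriv_comp_inl (dirDeriv_analytic hH _) b)) a).trans
      (dirDeriv_comp_inl (dirDeriv_analytic (dirDeriv_analytic hH _) _) a)

theorem dirDeriv_three_comp_fst {W : Set E} (hW : IsOpen W) {H : E → ℂ}
    (hH : AnalyticOnNhd ℂ H W) (a b c : E × F) :
    Set.EqOn (dirDeriv a (dirDeriv b (dirDeriv c fun p : E × F => H p.1)))
      (fun p => dirDeriv a.1 (dirDeriv b.1 (dirDeriv c.1 H)) p.1) (Prod.fst ⁻¹' W) := by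
  have hW' : IsOpen (Prod.fst ⁻¹' W : Set (E × F)) := hW.preimage continuous_fst
  exact (dirDeriv_eqOn hW' ((dirDeriv_eqOn hW' (dirDeriv_comp_fst hH c) b).trans
    (dirDeriv_comp_fst (dirDeriv_analytic hH _) b)) a).trans
      (dirDeriv_comp_fst (dirDeriv_analytic (dirDeriv_analytic hH _) _) a)

theorem dirDeriv_zero (f : E → ℂ) : dirDeriv 0 f = 0 := by
  funext x; simp [dirDeriv]

theorem dirDeriv_zero_fun (v : E) : dirDeriv v (0 : E → ℂ) = 0 := by
  funext x
  have : fderiv ℂ (0 : E → ℂ) x = 0 := by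
    rw [show (0 : E → ℂ) = fun _ => 0 from rfl]; simp
  simp [dirDeriv, this]

end Fibres

/-- A minor avoiding the border is a minor of the unbordered matrix; in any other minor each term
contains a derivative in `σ` or the zero corner, which kills a function of `S` alone. -/
theorem isCompSolution_of_isDeltaSolution {n : ℕ} {f : LagCover n → ℂ} (hf : IsDeltaSolution f) :
    IsCompSolution (constOnFibres f) := by
  obtain ⟨U, F, hU, hdet, hext, hsol⟩ := hf
  refine ⟨Prod.fst ⁻¹' U, fun t s _ => F t s, hU.preimage continuous_fst, fun p hp => hdet _ hp,
    fun q t ht => hext q.1.1 t ht, fun W r hW hr hsq => ?_⟩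
  have hrW : AnalyticOnNhd ℂ r (U ∩ W) := hr.mono Set.inter_subset_right
  obtain ⟨han, hmin⟩ := hsol (U ∩ W) r (hU.inter hW) Set.inter_subset_left hrW
    fun t ht => hsq t ht.2
  rw [← Set.preimage_inter]
  refine ⟨han.comp analyticOnNhd_fst fun _ h => h, fun I J p hp => ?_⟩
  have hr0 : ∀ t ∈ U ∩ W, r t ≠ 0 := by
    intro t ht h0
    have := hsq t ht.2
    rw [h0] at this
    exact hdet t ht.1 (by simpa using this.symm)
  have hH : AnalyticOnNhd ℂ (fun t => (r t)⁻¹ * F t (r t)) (U ∩ W) := (hrW.inv hr0).mul han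
  have h3 := fun a b c => dirDeriv_three_comp_fst (F := Fin n → ℂ) (hU.inter hW) hH a b c hp
  simp only [minorOp, h3]
  by_cases hI : ∀ k, ∃ i, I k = some i
  · by_cases hJ : ∀ k, ∃ j, J k = some j
    · choose i hi using hI
      choose j hj using hJ
      have := hmin ⟨i, fun a b hab => I.injective (by rw [hi, hi, hab])⟩
        ⟨j, fun a b hab => J.injective (by rw [hj, hj, hab])⟩ p.1 hp
      simp only [hi, hj, borderDir]
      exact this
    · push Not at hJ
      obtain ⟨k, hk⟩ := hJ
      have hk' : J k = none := Option.eq_none_iff_forall_ne_some.2 hk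
      refine Finset.sum_eq_zero fun π _ => ?_
      have h0 : ∀ i, (borderDir (n := n) i (J k)).1 = 0 := by
        intro i; rw [hk']; cases i <;> rfl
      fin_cases k <;> simp only [Fin.zero_eta, Fin.mk_one, Fin.reduceFinMk] at h0 <;>
        simp [h0, dirDeriv_zero, dirDeriv_zero_fun]
  · push Not at hI
    obtain ⟨k, hk⟩ := hI
    have hk' : I k = none := Option.eq_none_iff_forall_ne_some.2 hk
    refine Finset.sum_eq_zero fun π _ => ?_
    have h0 : ∀ j, (borderDir (n := n) (I k) j).1 = 0 := by
      intro j; rw [hk']; cases j <;> rfl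
    -- Each term of the determinant uses the border row exactly once, in some column `l`.
    obtain ⟨l, rfl⟩ := π.surjective k
    fin_cases l <;> simp only [Fin.zero_eta, Fin.mk_one, Fin.reduceFinMk] at h0 <;>
      simp [h0, dirDeriv_zero, dirDeriv_zero_fun]

/-- The point `σ = 0` lies in every fibre, so the extension can be restricted there; only the minors
avoiding the border are needed. -/
theorem isDeltaSolution_of_isCompSolution {n : ℕ} {f : LagCover n → ℂ}
    (hf : IsCompSolution (constOnFibres f)) : IsDeltaSolution f := by
  obtain ⟨O, G, hO, hdet, hext, hsol⟩ := hf
  refine ⟨(fun t => (t, 0)) ⁻¹' O, fun t s => G t s 0, hO.preimage (by fun_prop),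
    fun t ht => hdet _ ht, fun x t ht => hext ⟨(x, 0), by simp⟩ t ht,
    fun W r hW hWU hr hsq => ?_⟩
  obtain ⟨han, hmin⟩ := hsol W r hW hr hsq
  have hsub : W ⊆ (fun t : SymCoord n => (t, (0 : Fin n → ℂ))) ⁻¹' (O ∩ Prod.fst ⁻¹' W) :=
    fun t ht => ⟨hWU ht, ht⟩
  refine ⟨(analyticOnNhd_comp_inl han).mono hsub, fun I J t ht => ?_⟩
  have hr0 : ∀ t ∈ W, r t ≠ 0 := by
    intro t ht h0
    have := hsq t ht
    rw [h0] at this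
    exact hdet _ (hWU ht) (by simpa using this.symm)
  have hH : AnalyticOnNhd ℂ (fun p : SymCoord n × (Fin n → ℂ) => (r p.1)⁻¹ * G p.1 (r p.1) p.2)
      (O ∩ Prod.fst ⁻¹' W) :=
    ((hr.inv hr0).comp analyticOnNhd_fst fun _ h => h.2).mul han
  have h3 := fun a b c => dirDeriv_three_comp_inl (hO.inter (hW.preimage continuous_fst)) hH a b c
    (hsub ht)
  have := hmin (I.trans Function.Embedding.some) (J.trans Function.Embedding.some) (t, 0) (hsub ht)
  simp only [minorOp, h3]
  simpa [minorOp, borderDir] using this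

/-! ### Rank one solutions in the coordinates `T` and `T⁻¹` -/

section RankOneSolutions

variable {n : ℕ}

theorem toMat_transpose (t : SymCoord n) : (toMat t)ᵀ = toMat t := by
  ext i j
  simp [toMat, Sym2.eq_swap]

/-- The factor 2 on the diagonal is what makes this formula uniform in `i` and `j`. -/
theorem toMat_symDir (i j : Fin n) :
    toMat (symDir i j) = Matrix.single i j (1 : ℂ) + Matrix.single j i 1 := by
  ext k l
  simp only [toMat, symDir, Matrix.of_apply, Matrix.add_apply, Matrix.single_apply, Pi.single_apply,
    Sym2.eq_iff]
  by_cases h1 : i = k ∧ j = l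
  · obtain ⟨rfl, rfl⟩ := h1
    by_cases h : i = j
    · subst h; norm_num
    · simp [h, Ne.symm h]
  · by_cases h2 : j = k ∧ i = l
    · obtain ⟨rfl, rfl⟩ := h2
      by_cases h : i = j
      · subst h; simp at h1
      · simp [h, Ne.symm h]
    · have h3 : ¬((k = i ∧ l = j) ∨ (k = j ∧ l = i)) := by
        rintro (⟨rfl, rfl⟩ | ⟨rfl, rfl⟩)
        · exact h1 ⟨rfl, rfl⟩
        · exact h2 ⟨rfl, rfl⟩
      simp [h1, h2, h3]

/-- The bilinear form `aᵗ M b`. -/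
def bil (M : Matrix (Fin n) (Fin n) ℂ) (a b : Fin n → ℂ) : ℂ := a ⬝ᵥ (M *ᵥ b)

theorem bil_comm {M : Matrix (Fin n) (Fin n) ℂ} (hM : Mᵀ = M) (a b : Fin n → ℂ) :
    bil M a b = bil M b a := by
  rw [bil, Matrix.dotProduct_mulVec, dotProduct_comm, ← Matrix.mulVec_transpose, hM, bil]

/-- With `M = T⁻¹` this evaluates the derivative `-T⁻¹ V T⁻¹` of the inverse. -/
theorem bil_mul_symDir_mul {M : Matrix (Fin n) (Fin n) ℂ} (hM : Mᵀ = M) (i j : Fin n)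
    (a b : Fin n → ℂ) :
    bil (M * toMat (symDir i j) * M) a b =
      bil M (Pi.single i 1) a * bil M (Pi.single j 1) b +
        bil M (Pi.single j 1) a * bil M (Pi.single i 1) b := by
  have key : ∀ k l : Fin n, bil (M * Matrix.single k l 1 * M) a b =
      bil M (Pi.single k 1) a * bil M (Pi.single l 1) b := by
    intro k l
    rw [bil_comm hM _ a]
    simp only [bil]
    rw [Matrix.mul_assoc, ← Matrix.mulVec_mulVec, ← Matrix.mulVec_mulVec, Matrix.single_mulVec_eq,
      Matrix.mulVec_smul, dotProduct_smul, single_one_dotProduct, one_mul, smul_eq_mul, mul_comm]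
  rw [toMat_symDir, Matrix.mul_add, Matrix.add_mul]
  simp only [bil, Matrix.add_mulVec, dotProduct_add] at key ⊢
  rw [key, key]

theorem bil_symDir (i j : Fin n) (a b : Fin n → ℂ) :
    bil (toMat (symDir i j)) a b = a i * b j + a j * b i := by
  simp [bil, toMat_symDir, Matrix.add_mulVec, Matrix.single_mulVec_eq, mul_comm]

/-- `f` has derivative `f'` at `x` in the direction `v`. -/
def HasDirDeriv {E : Type*} [NormedAddCommGroup E] [NormedSpace ℂ E] (f : E → ℂ) (f' : ℂ)
    (x v : E) : Prop :=
  HasDerivAt (fun h : ℂ => f (x + h • v)) f' 0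

theorem dirDeriv_eq_of_hasDirDeriv {E : Type*} [NormedAddCommGroup E] [NormedSpace ℂ E]
    {f : E → ℂ} {f' : ℂ} {x v : E} (hf : AnalyticAt ℂ f x) (h : HasDirDeriv f f' x v) :
    dirDeriv v f x = f' := by
  have h1 := hf.differentiableAt.lineDeriv_eq_fderiv (v := v)
  rw [dirDeriv, ← h1]
  exact HasDerivAt.deriv h

theorem hasDirDeriv_of_analyticAt {E : Type*} [NormedAddCommGroup E] [NormedSpace ℂ E]
    {f : E → ℂ} {x : E} (v : E) (hf : AnalyticAt ℂ f x) : HasDirDeriv f (dirDeriv v f x) x v :=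
  hf.differentiableAt.hasFDerivAt.hasLineDerivAt v

section HasDirDeriv

variable {E : Type*} [NormedAddCommGroup E] [NormedSpace ℂ E] {f g : E → ℂ} {f' g' : ℂ} {x v : E}

theorem HasDirDeriv.mul (hf : HasDirDeriv f f' x v) (hg : HasDirDeriv g g' x v) :
    HasDirDeriv (fun t => f t * g t) (f' * g x + f x * g') x v := by
  simpa using! HasDerivAt.fun_mul hf hg

theorem HasDirDeriv.add (hf : HasDirDeriv f f' x v) (hg : HasDirDeriv g g' x v) :
    HasDirDeriv (fun t => f t + g t) (f' + g') x v :=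
  HasDerivAt.fun_add hf hg

theorem HasDirDeriv.const_mul (c : ℂ) (hf : HasDirDeriv f f' x v) :
    HasDirDeriv (fun t => c * f t) (c * f') x v :=
  HasDerivAt.const_mul c hf

theorem HasDirDeriv.neg (hf : HasDirDeriv f f' x v) : HasDirDeriv (fun t => -f t) (-f') x v :=
  HasDerivAt.fun_neg hf

theorem HasDirDeriv.pow (hf : HasDirDeriv f f' x v) (e : ℕ) :
    HasDirDeriv (fun t => f t ^ e) (e * f x ^ (e - 1) * f') x v := by
  simpa using! HasDerivAt.fun_pow hf e

theorem HasDirDeriv.inv (hf : HasDirDeriv f f' x v) (hx : f x ≠ 0) :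
    HasDirDeriv (fun t => (f t)⁻¹) (-f' / f x ^ 2) x v := by
  simpa using! HasDerivAt.inv hf (by simpa using hx)

theorem HasDirDeriv.congr_deriv (hf : HasDirDeriv f f' x v) (h : f' = g') :
    HasDirDeriv f g' x v :=
  h ▸ hf

end HasDirDeriv

theorem hasDirDeriv_comp_inverse {E A : Type*} [NormedAddCommGroup E] [NormedSpace ℂ E]
    [NormedRing A] [NormedAlgebra ℂ A] [HasSummableGeomSeries A] (L : E →L[ℂ] A) (φ : A →L[ℂ] ℂ)
    {x : E} (hx : IsUnit (L x)) (v : E) :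
    HasDirDeriv (fun t => φ (Ring.inverse (L t)))
      (-φ (Ring.inverse (L x) * L v * Ring.inverse (L x))) x v := by
  obtain ⟨u, hu⟩ := hx
  have h1 := hasFDerivAt_ringInverse (𝕜 := ℂ) u
  rw [hu] at h1
  have h2 := (φ.hasFDerivAt.comp x (h1.comp x L.hasFDerivAt)).hasLineDerivAt v
  convert! h2 using 1
  simp [← hu]

-- Derivatives of `T`, `T⁻¹` and the square root of the determinant

attribute [local instance] Matrix.linftyOpNormedRing Matrix.linftyOpNormedAlgebra

/-- `toMat` as a continuous linear map. -/
def toMatL (n : ℕ) : SymCoord n →L[ℂ] Matrix (Fin n) (Fin n) ℂ :=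
  LinearMap.toContinuousLinearMap
    { toFun := toMat
      map_add' := fun _ _ => rfl
      map_smul' := fun _ _ => rfl }

/-- `M ↦ aᵗ M b` as a continuous linear map. -/
def bilL (a b : Fin n → ℂ) : Matrix (Fin n) (Fin n) ℂ →L[ℂ] ℂ :=
  LinearMap.toContinuousLinearMap
    { toFun := fun M => bil M a b
      map_add' := fun _ _ => by simp [bil, Matrix.add_mulVec]
      map_smul' := fun _ _ => by simp [bil, Matrix.smul_mulVec] }

theorem bil_toMat_analytic (a b : Fin n → ℂ) (W : Set (SymCoord n)) :
    AnalyticOnNhd ℂ (fun t => bil (toMat t) a b) W :=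
  ((bilL a b).comp (toMatL n)).analyticOnNhd _

theorem bil_toMat_hasDirDeriv (a b : Fin n → ℂ) (x : SymCoord n) (i j : Fin n) :
    HasDirDeriv (fun t => bil (toMat t) a b) (a i * b j + a j * b i) x (symDir i j) := by
  rw [← bil_symDir]
  exact ((bilL a b).comp (toMatL n)).hasFDerivAt.hasLineDerivAt (symDir i j)

theorem bil_inv_analyticAt (a b : Fin n → ℂ) {x : SymCoord n} (hx : (toMat x).det ≠ 0) :
    AnalyticAt ℂ (fun t => bil (toMat t)⁻¹ a b) x := by
  obtain ⟨u, hu⟩ : IsUnit (toMat x) := (Matrix.isUnit_iff_isUnit_det _).2 (Ne.isUnit hx)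
  have h1 : AnalyticAt ℂ (Ring.inverse : Matrix (Fin n) (Fin n) ℂ → _) (toMatL n x) := by
    change AnalyticAt ℂ _ (toMat x)
    rw [← hu]
    exact analyticAt_inverse u
  have h2 := (h1.comp ((toMatL n).analyticAt x))
  have h3 := ((bilL a b).analyticAt _).comp h2
  refine h3.congr (Filter.Eventually.of_forall fun t => ?_)
  simp only [Matrix.nonsing_inv_eq_ringInverse]
  rfl

theorem bil_inv_hasDirDeriv (a b : Fin n → ℂ) {x : SymCoord n} (hx : (toMat x).det ≠ 0)
    (i j : Fin n) :
    HasDirDeriv (fun t => bil (toMat t)⁻¹ a b)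
      (-(bil (toMat x)⁻¹ (Pi.single i 1) a * bil (toMat x)⁻¹ (Pi.single j 1) b +
        bil (toMat x)⁻¹ (Pi.single j 1) a * bil (toMat x)⁻¹ (Pi.single i 1) b)) x (symDir i j) := by
  have hu : IsUnit (toMatL n x) := (Matrix.isUnit_iff_isUnit_det _).2 (Ne.isUnit hx)
  have hsymm : ((toMat x)⁻¹)ᵀ = (toMat x)⁻¹ := by
    rw [Matrix.transpose_nonsing_inv, toMat_transpose]
  rw [← bil_mul_symDir_mul hsymm]
  have h := hasDirDeriv_comp_inverse (toMatL n) (bilL a b) hu (symDir i j)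
  simp only [Matrix.nonsing_inv_eq_ringInverse]
  exact h

/-- Jacobi's formula gives `tr(T⁻¹V) = 2 (T⁻¹)ᵢⱼ` as logarithmic derivative of `det`; the square
root takes half of it. The branch `r` is known only through `r² = det`, so both sides are
differentiated and `2r` is cancelled. -/
theorem sqrtDet_hasDirDeriv {r : SymCoord n → ℂ} {W : Set (SymCoord n)} (hW : IsOpen W)
    (hr : AnalyticOnNhd ℂ r W) (hsq : ∀ t ∈ W, r t ^ 2 = (toMat t).det)
    (hdet : ∀ t ∈ W, (toMat t).det ≠ 0) {x : SymCoord n} (hx : x ∈ W) (i j : Fin n) :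
    HasDirDeriv r (bil (toMat x)⁻¹ (Pi.single i 1) (Pi.single j 1) * r x) x (symDir i j) := by
  have h0 := hasDirDeriv_of_analyticAt (symDir i j) (hr x hx)
  have h1 : HasDerivAt (fun h : ℂ => r (x + h • symDir i j) ^ 2)
      (2 * r x * dirDeriv (symDir i j) r x) 0 := by
    simpa using! h0.pow 2
  set Y := (toMat x)⁻¹ with hY
  set V := toMat (symDir i j) with hV
  have hdx := hdet x hx
  have hTY : toMat x * Y = 1 := Matrix.mul_nonsing_inv _ (Ne.isUnit hdx)
  -- Expansion of `det(1 + hM)` to first order in `h`, with a polynomial multiple of `h²` as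
  -- remainder.
  have hline : ∀ h : ℂ, (toMat (x + h • symDir i j)).det =
      (toMat x).det * (1 + Matrix.trace (Y * V) * h +
        ((1 + (Polynomial.X : Polynomial ℂ) • (Y * V).map Polynomial.C).det.divX.divX).eval h
          * h ^ 2) := by
    intro h
    rw [← Matrix.det_one_add_smul, ← Matrix.det_mul, mul_add, mul_one, Matrix.mul_smul,
      ← Matrix.mul_assoc, hTY, one_mul]
    rfl
  have h2 : HasDerivAt (fun h : ℂ => (toMat (x + h • symDir i j)).det)
      ((toMat x).det * Matrix.trace (Y * V)) 0 := by
    simp only [hline]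
    have hp := ((1 + (Polynomial.X : Polynomial ℂ) • (Y * V).map Polynomial.C).det.divX.divX
      ).hasDerivAt (0 : ℂ)
    simpa using ((((hasDerivAt_id' (0 : ℂ)).const_mul (Matrix.trace (Y * V))).const_add 1).fun_add
      (hp.fun_mul ((hasDerivAt_id' (0 : ℂ)).fun_pow 2))).const_mul (toMat x).det
  have hev : (fun h : ℂ => r (x + h • symDir i j) ^ 2) =ᶠ[nhds 0]
      fun h => (toMat (x + h • symDir i j)).det := by
    have hc : ContinuousAt (fun h : ℂ => x + h • symDir i j) 0 := by fun_prop
    have : W ∈ nhds (x + (0 : ℂ) • symDir i j) := by simpa using hW.mem_nhds hx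
    filter_upwards [hc this] with h hh using hsq _ hh
  have h3 := h1.unique (h2.congr_of_eventuallyEq hev)
  have hr0 : r x ≠ 0 := fun h => hdx (by rw [← hsq x hx, h]; simp)
  have hsymm : Yᵀ = Y := by rw [hY, Matrix.transpose_nonsing_inv, toMat_transpose]
  have htr : Matrix.trace (Y * V) = 2 * bil Y (Pi.single i 1) (Pi.single j 1) := by
    have e : ∀ k l, bil Y (Pi.single k 1) (Pi.single l 1) = Y k l := by
      intro k l; simp [bil]
    have e' : Y j i = Y i j := congrFun (congrFun hsymm i) j
    rw [hV, toMat_symDir, Matrix.mul_add, Matrix.trace_add, e, Matrix.trace_mul_single,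
      Matrix.trace_mul_single, e']
    simp only [MulOpposite.op_one, one_smul]
    ring
  have h4 : dirDeriv (symDir i j) r x = bil Y (Pi.single i 1) (Pi.single j 1) * r x := by
    rw [htr, ← hsq x hx] at h3
    have : r x * (dirDeriv (symDir i j) r x - bil Y (Pi.single i 1) (Pi.single j 1) * r x) = 0 := by
      linear_combination h3 / 2
    rcases mul_eq_zero.1 this with h | h
    · exact absurd h hr0
    · exact sub_eq_zero.1 h
  rwa [h4] at h0

/-- Each derivative only brings out a factor `2xᵢxⱼ`, so second derivatives are symmetric in all
four indices. -/
theorem rankOneOn_bil_pow (x : Fin n → ℂ) (e : ℕ) {W : Set (SymCoord n)} (hW : IsOpen W) :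
    RankOneOn symDir W fun t => bil (toMat t) x x ^ e := by
  have hq := bil_toMat_analytic x x W
  have hfirst : ∀ k l, Set.EqOn (dirDeriv (symDir k l) fun t => bil (toMat t) x x ^ e)
      (fun t => (e : ℂ) * (2 * x k * x l) * bil (toMat t) x x ^ (e - 1)) W := by
    intro k l t ht
    refine dirDeriv_eq_of_hasDirDeriv (hq.pow e t ht) ?_
    exact ((bil_toMat_hasDirDeriv x x t k l).pow e).congr_deriv (by ring)
  refine ⟨hq.pow e, fun i j k l t ht => ?_⟩
  have hsecond := fun i j k l => (dirDeriv_eqOn hW (hfirst k l) (symDir i j) ht).trans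
    (dirDeriv_eq_of_hasDirDeriv ((analyticOnNhd_const.mul (hq.pow (e - 1))) t ht)
      (((bil_toMat_hasDirDeriv x x t i j).pow (e - 1)).const_mul ((e : ℂ) * (2 * x k * x l))))
  rw [hsecond, hsecond]
  ring

/-- Write `β` for the form of `T⁻¹`. Differentiating `β(y,y)^e` twice produces `β` paired between
the two index pairs, but never `βᵢⱼ` or `βₖₗ`; differentiating `r⁻¹` supplies exactly these, and the
second derivative becomes symmetric in `i, j, k, l`. -/
theorem rankOneOn_inv_mul_bil_inv_pow (y : Fin n → ℂ) (e : ℕ) {r : SymCoord n → ℂ}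
    {W : Set (SymCoord n)} (hW : IsOpen W) (hr : AnalyticOnNhd ℂ r W)
    (hsq : ∀ t ∈ W, r t ^ 2 = (toMat t).det) (hdet : ∀ t ∈ W, (toMat t).det ≠ 0) :
    RankOneOn symDir W fun t => (r t)⁻¹ * bil (toMat t)⁻¹ y y ^ e := by
  have hr0 : ∀ t ∈ W, r t ≠ 0 := fun t ht h => hdet t ht (by rw [← hsq t ht, h]; simp)
  have hR : AnalyticOnNhd ℂ (fun t => (r t)⁻¹) W := hr.inv hr0
  have hβ : ∀ a b, AnalyticOnNhd ℂ (fun t => bil (toMat t)⁻¹ a b) W :=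
    fun a b t ht => bil_inv_analyticAt a b (hdet t ht)
  have hP : AnalyticOnNhd ℂ (fun t => (r t)⁻¹ * bil (toMat t)⁻¹ y y ^ e) W :=
    hR.mul ((hβ y y).pow e)
  have dR : ∀ i j, ∀ t ∈ W, HasDirDeriv (fun t => (r t)⁻¹)
      (-(bil (toMat t)⁻¹ (Pi.single i 1) (Pi.single j 1) * (r t)⁻¹)) t (symDir i j) := by
    intro i j t ht
    have h1 := sqrtDet_hasDirDeriv hW hr hsq hdet ht i j
    have hrt := hr0 t ht
    exact (h1.inv hrt).congr_deriv (by field_simp)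
  have dβ := fun (a b : Fin n → ℂ) (i j : Fin n) (t : SymCoord n) (ht : t ∈ W) =>
    bil_inv_hasDirDeriv a b (hdet t ht) i j
  have hfirst : ∀ k l, Set.EqOn
      (dirDeriv (symDir k l) fun t => (r t)⁻¹ * bil (toMat t)⁻¹ y y ^ e)
      (fun t => -((r t)⁻¹ * (bil (toMat t)⁻¹ (Pi.single k 1) (Pi.single l 1) *
        bil (toMat t)⁻¹ y y ^ e + 2 * e * bil (toMat t)⁻¹ y y ^ (e - 1) *
        (bil (toMat t)⁻¹ (Pi.single k 1) y * bil (toMat t)⁻¹ (Pi.single l 1) y)))) W := by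
    intro k l t ht
    refine dirDeriv_eq_of_hasDirDeriv (hP t ht) ?_
    exact ((dR k l t ht).mul ((dβ y y k l t ht).pow e)).congr_deriv (by ring)
  refine ⟨hP, fun i j k l t ht => ?_⟩
  have hsecond := fun i j k l => (dirDeriv_eqOn hW (hfirst k l) (symDir i j) ht).trans
    (dirDeriv_eq_of_hasDirDeriv ((hR.mul (((hβ _ _).mul ((hβ y y).pow e)).add
      ((analyticOnNhd_const.mul ((hβ y y).pow (e - 1))).mul ((hβ _ _).mul (hβ _ _))))).neg t ht)
    ((dR i j t ht).mul (((dβ _ _ i j t ht).mul ((dβ y y i j t ht).pow e)).add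
      ((((dβ y y i j t ht).pow (e - 1)).const_mul (2 * (e : ℂ))).mul
        ((dβ _ _ i j t ht).mul (dβ _ _ i j t ht))))).neg)
  have hsymm : ((toMat t)⁻¹)ᵀ = (toMat t)⁻¹ := by
    rw [Matrix.transpose_nonsing_inv, toMat_transpose]
  rw [hsecond, hsecond]
  rw [bil_comm hsymm (Pi.single j 1) (Pi.single k 1), bil_comm hsymm (Pi.single i 1) (Pi.single k 1),
    bil_comm hsymm (Pi.single j 1) (Pi.single i 1)]
  ring

end RankOneSolutions

/-! ### The space of solutions -/

section Solutions

variable {n : ℕ}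

theorem LagCover.det_ne_zero (x : LagCover n) : x.T.det ≠ 0 := by
  have h := congrArg Matrix.det (Matrix.mem_unitaryGroup_iff.1 x.unitary)
  rw [Matrix.det_mul, Matrix.det_one] at h
  exact left_ne_zero_of_mul_eq_one h

/-- `F` is a multivalued holomorphic function on all invertible symmetric matrices, with two
branches labelled by the square roots of the determinant, and solves the determinantal system. -/
def IsDetSolution (F : SymCoord n → ℂ → ℂ) : Prop :=
  ∀ (W : Set (SymCoord n)) (r : SymCoord n → ℂ), IsOpen W → (∀ t ∈ W, (toMat t).det ≠ 0) →
    AnalyticOnNhd ℂ r W → (∀ t ∈ W, r t ^ 2 = (toMat t).det) →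
    AnalyticOnNhd ℂ (fun t => F t (r t)) W ∧
    ∀ (I J : Fin 3 ↪ Fin n), ∀ t ∈ W, minorOp symDir I J (fun t => (r t)⁻¹ * F t (r t)) t = 0

theorem sqrtDet_ne_zero {W : Set (SymCoord n)} {r : SymCoord n → ℂ}
    (hdet : ∀ t ∈ W, (toMat t).det ≠ 0) (hsq : ∀ t ∈ W, r t ^ 2 = (toMat t).det) :
    ∀ t ∈ W, r t ≠ 0 :=
  fun t ht h => hdet t ht (by rw [← hsq t ht, h]; simp)

/-- The solutions that extend to all invertible symmetric matrices. -/
def globalSolutions (n : ℕ) : Submodule ℂ (LagCover n → ℂ) where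
  carrier := {f | ∃ F, IsDetSolution F ∧
    ∀ (x : LagCover n) (t : SymCoord n), toMat t = x.T → F t x.s = f x}
  zero_mem' := by
    refine ⟨0, fun W r _ _ _ _ => ⟨analyticOnNhd_const, fun I J t _ => ?_⟩, fun _ _ _ => rfl⟩
    have : (fun t => (r t)⁻¹ * (0 : SymCoord n → ℂ → ℂ) t (r t)) = (0 : ℂ) • (0 : SymCoord n → ℂ) := by
      funext t; simp
    rw [this, minorOp_smul, zero_smul]
    rfl
  add_mem' := by
    rintro f g ⟨F, hF, hf⟩ ⟨G, hG, hg⟩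
    refine ⟨F + G, fun W r hW hdet hr hsq => ?_, fun x t h => by simp [hf x t h, hg x t h]⟩
    obtain ⟨hF1, hF2⟩ := hF W r hW hdet hr hsq
    obtain ⟨hG1, hG2⟩ := hG W r hW hdet hr hsq
    have hR : AnalyticOnNhd ℂ (fun t => (r t)⁻¹) W := hr.inv (sqrtDet_ne_zero hdet hsq)
    refine ⟨hF1.add hG1, fun I J t ht => ?_⟩
    have : (fun t => (r t)⁻¹ * (F + G) t (r t)) =
        (fun t => (r t)⁻¹ * F t (r t)) + fun t => (r t)⁻¹ * G t (r t) := by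
      funext t; simp [mul_add]
    rw [this, minorOp_add symDir I J hW (hR.mul hF1) (hR.mul hG1) ht, Pi.add_apply, hF2 I J t ht,
      hG2 I J t ht, add_zero]
  smul_mem' := by
    rintro c f ⟨F, hF, hf⟩
    refine ⟨c • F, fun W r hW hdet hr hsq => ?_, fun x t h => by simp [hf x t h]⟩
    obtain ⟨hF1, hF2⟩ := hF W r hW hdet hr hsq
    refine ⟨analyticOnNhd_const.mul hF1, fun I J t ht => ?_⟩
    have : (fun t => (r t)⁻¹ * (c • F) t (r t)) = c • fun t => (r t)⁻¹ * F t (r t) := by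
      funext t; simp; ring
    rw [this, minorOp_smul, Pi.smul_apply, hF2 I J t ht, smul_zero]

theorem isDeltaSolution_of_mem_globalSolutions {f : LagCover n → ℂ} (hf : f ∈ globalSolutions n) :
    IsDeltaSolution f := by
  obtain ⟨F, hF, hf⟩ := hf
  refine ⟨{t | (toMat t).det ≠ 0}, F, ?_, fun t h => h,
    fun x t h => ⟨by rw [Set.mem_ofPred_eq, h]; exact x.det_ne_zero, hf x t h⟩,
    fun W r hW hWU hr hsq => hF W r hW hWU hr hsq⟩
  have : Continuous fun t : SymCoord n => (toMat t).det := by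
    refine Continuous.matrix_det ?_
    exact continuous_matrix fun i j => continuous_apply _
  exact isOpen_ne_fun this continuous_const

/-- The weight `r⁻¹` in the system cancels the factor `r` and leaves a product of two rank one
functions. -/
theorem isDetSolution_of_mul {F : SymCoord n → ℂ → ℂ}
    (h : ∀ (W : Set (SymCoord n)) (r : SymCoord n → ℂ), IsOpen W →
      (∀ t ∈ W, (toMat t).det ≠ 0) → AnalyticOnNhd ℂ r W → (∀ t ∈ W, r t ^ 2 = (toMat t).det) →
      ∃ P Q, RankOneOn symDir W P ∧ RankOneOn symDir W Q ∧
        ∀ t ∈ W, F t (r t) = r t * (P t * Q t)) : IsDetSolution F := by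
  intro W r hW hdet hr hsq
  obtain ⟨P, Q, hP, hQ, hF⟩ := h W r hW hdet hr hsq
  have hr0 := sqrtDet_ne_zero hdet hsq
  refine ⟨(hr.mul (hP.analytic.mul hQ.analytic)).congr hW fun t ht => (hF t ht).symm,
    fun I J t ht => ?_⟩
  have heq : Set.EqOn (fun t => (r t)⁻¹ * F t (r t)) (P * Q) W := by
    intro t ht
    have := hr0 t ht
    simp only [hF t ht, Pi.mul_apply]
    field_simp
  rw [minorOp_eqOn symDir I J hW heq ht]
  exact RankOneOn.minorOp_mul hW hP hQ I J ht

/-- Each rank one factor of the inverse type carries an `s⁻¹`. Using none, one or two of them gives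
this statement and the following two. -/
theorem s_mul_bil_pow_mem_globalSolutions (a b : Fin n → ℂ) (e f : ℕ) :
    (fun x => x.s * (bil x.T a a ^ e * bil x.T b b ^ f)) ∈ globalSolutions n := by
  refine ⟨fun t s => s * (bil (toMat t) a a ^ e * bil (toMat t) b b ^ f),
    isDetSolution_of_mul fun W r hW _ _ _ => ⟨_, _, rankOneOn_bil_pow a e hW,
      rankOneOn_bil_pow b f hW, fun _ _ => rfl⟩, fun x t h => by simp only [h]⟩

theorem bil_pow_mul_bil_inv_pow_mem_globalSolutions (a b : Fin n → ℂ) (e f : ℕ) :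
    (fun x => bil x.T a a ^ e * bil x.T⁻¹ b b ^ f) ∈ globalSolutions n := by
  refine ⟨fun t _ => bil (toMat t) a a ^ e * bil (toMat t)⁻¹ b b ^ f,
    isDetSolution_of_mul fun W r hW hdet hr hsq => ⟨_, _, rankOneOn_bil_pow a e hW,
      rankOneOn_inv_mul_bil_inv_pow b f hW hr hsq hdet, fun t ht => ?_⟩, fun x t h => by simp only [h]⟩
  have := sqrtDet_ne_zero hdet hsq t ht
  field_simp

theorem inv_s_mul_bil_inv_pow_mem_globalSolutions (a b : Fin n → ℂ) (e f : ℕ) :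
    (fun x => x.s⁻¹ * (bil x.T⁻¹ a a ^ e * bil x.T⁻¹ b b ^ f)) ∈ globalSolutions n := by
  refine ⟨fun t s => s⁻¹ * (bil (toMat t)⁻¹ a a ^ e * bil (toMat t)⁻¹ b b ^ f),
    isDetSolution_of_mul fun W r hW hdet hr hsq => ⟨_, _,
      rankOneOn_inv_mul_bil_inv_pow a e hW hr hsq hdet,
      rankOneOn_inv_mul_bil_inv_pow b f hW hr hsq hdet, fun t ht => ?_⟩, fun x t h => by simp only [h]⟩
  have := sqrtDet_ne_zero hdet hsq t ht
  field_simp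

end Solutions

/-! ### Extraction of coefficients -/

section Coefficients

/-- A linear functional on the quotient by `S` turns the sum into a polynomial in `p` that vanishes
identically, so its coefficients vanish. -/
theorem mem_of_forall_sum_pow_smul_mem {M : Type*} [AddCommGroup M] [Module ℂ M]
    (S : Submodule ℂ M) (N : ℕ) (m : ℕ → M)
    (h : ∀ p : ℂ, ∑ k ∈ Finset.range N, p ^ k • m k ∈ S) (k : ℕ) (hk : k < N) : m k ∈ S := by
  rw [← Submodule.Quotient.mk_eq_zero, ← Module.forall_dual_apply_eq_zero_iff ℂ]
  intro φ
  set P : Polynomial ℂ := ∑ k ∈ Finset.range N, Polynomial.monomial k (φ (Submodule.Quotient.mk (m k)))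
    with hP
  have hP0 : P = 0 := by
    refine Polynomial.funext fun p => ?_
    have := congrArg φ ((Submodule.Quotient.mk_eq_zero S).2 (h p))
    rw [← Submodule.mkQ_apply, map_sum, map_sum, map_zero] at this
    rw [hP, Polynomial.eval_finsetSum, Polynomial.eval_zero, ← this]
    refine Finset.sum_congr rfl fun k _ => ?_
    rw [Polynomial.eval_monomial, map_smul, map_smul, smul_eq_mul, mul_comm, Submodule.mkQ_apply]
  have := congrArg (fun Q => Polynomial.coeff Q k) hP0
  simpa [hP, Polynomial.finsetSum_coeff, Polynomial.coeff_monomial, hk] using this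

variable {A : Type*} [CommRing A] [Algebra ℂ A]

/-- Products of powers of the values at rank one forms span all polynomials in the entries of a
symmetric `2 × 2` matrix. -/
theorem monomial_mem_of_rankOne_pow_mem (S : Submodule ℂ A) (c q₁ q₂ q₃ : A)
    (h : ∀ (p : ℂ) (e f : ℕ), c * ((q₁ + (2 * p) • q₂ + p ^ 2 • q₃) ^ e * q₃ ^ f) ∈ S)
    (i j k : ℕ) : c * (q₁ ^ i * q₂ ^ j * q₃ ^ k) ∈ S := by
  -- The term `p² q₃` can be removed because the power of `q₃` in the hypothesis is arbitrary and
  -- absorbs the binomial expansion.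
  have h1 : ∀ (p : ℂ) (e f : ℕ), c * ((q₁ + (2 * p) • q₂) ^ e * q₃ ^ f) ∈ S := by
    intro p e f
    have : q₁ + (2 * p) • q₂ = (q₁ + (2 * p) • q₂ + p ^ 2 • q₃) + (-p ^ 2) • q₃ := by
      rw [add_assoc, ← add_smul]; simp
    rw [this, add_pow, Finset.sum_mul, Finset.mul_sum]
    refine S.sum_mem fun l _ => ?_
    convert S.smul_mem (((-p ^ 2) ^ (e - l)) * (e.choose l : ℂ)) (h p l (e - l + f)) using 1
    simp only [Algebra.smul_def, mul_pow, pow_add, map_mul, map_natCast, map_pow]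
    ring
  -- The coefficient of `p ^ j` is the wanted monomial times a nonzero number.
  have h2 := mem_of_forall_sum_pow_smul_mem S (i + j + 1)
    (fun l => (2 ^ l * ((i + j).choose l) : ℂ) • (c * (q₁ ^ (i + j - l) * q₂ ^ l * q₃ ^ k)))
    (fun p => by
      convert h1 p (i + j) k using 1
      rw [add_comm q₁, add_pow, Finset.sum_mul, Finset.mul_sum]
      refine Finset.sum_congr rfl fun l _ => ?_
      simp only [Algebra.smul_def, mul_pow, map_mul, map_natCast, map_pow]
      ring) j (by omega)
  have hne : (2 ^ j * ((i + j).choose j) : ℂ) ≠ 0 :=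
    mul_ne_zero (by simp) (Nat.cast_ne_zero.2 (Nat.choose_pos (by omega)).ne')
  have h3 := S.smul_mem (2 ^ j * ((i + j).choose j) : ℂ)⁻¹ h2
  rwa [smul_smul, inv_mul_cancel₀ hne, one_smul, Nat.add_sub_cancel] at h3

theorem pow_mul_det_pow_mem_of_rankOne_pow_mem (S : Submodule ℂ A) (c q₁ q₂ q₃ : A)
    (h : ∀ (p : ℂ) (e f : ℕ), c * ((q₁ + (2 * p) • q₂ + p ^ 2 • q₃) ^ e * q₃ ^ f) ∈ S)
    (a b : ℕ) : c * (q₁ ^ a * (q₁ * q₃ - q₂ * q₂) ^ b) ∈ S := by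
  -- All exponents are general because each determinant factor multiplied out shifts them.
  have key : ∀ b i j k : ℕ, c * (q₁ ^ i * q₂ ^ j * q₃ ^ k * (q₁ * q₃ - q₂ * q₂) ^ b) ∈ S := by
    intro b
    induction b with
    | zero =>
      intro i j k
      simpa using monomial_mem_of_rankOne_pow_mem S c q₁ q₂ q₃ h i j k
    | succ b ih =>
      intro i j k
      convert S.sub_mem (ih (i + 1) j (k + 1)) (ih i (j + 2) k) using 1
      ring
  simpa using key b a 0 0

end Coefficients

/-! ### Solutions containing powers of 2×2 minors -/

section Solutions

variable {n : ℕ}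

theorem bil_add_smul {M : Matrix (Fin n) (Fin n) ℂ} (hM : Mᵀ = M) (a b : Fin n → ℂ) (p : ℂ) :
    bil M (a + p • b) (a + p • b) = bil M a a + 2 * p * bil M a b + p ^ 2 * bil M b b := by
  have hc := bil_comm hM b a
  simp only [bil] at hc ⊢
  simp only [Matrix.mulVec_add, Matrix.mulVec_smul, dotProduct_add, add_dotProduct,
    dotProduct_smul, smul_dotProduct, smul_eq_mul, hc]
  ring

/-- Polarization along `w₁ + p w₂`. The vectors are arbitrary so that the columns of a unitary
matrix can be inserted, which covers every translate of a generator. -/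
theorem s_mul_minor_mem_globalSolutions (w₁ w₂ : Fin n → ℂ) (a b : ℕ) :
    (fun x => x.s * (bil x.T w₁ w₁ ^ a *
      (bil x.T w₁ w₁ * bil x.T w₂ w₂ - bil x.T w₁ w₂ * bil x.T w₁ w₂) ^ b)) ∈
      globalSolutions n := by
  refine pow_mul_det_pow_mem_of_rankOne_pow_mem (globalSolutions n) (fun x => x.s)
    (fun x => bil x.T w₁ w₁) (fun x => bil x.T w₁ w₂) (fun x => bil x.T w₂ w₂)
    (fun p e f => ?_) a b
  convert s_mul_bil_pow_mem_globalSolutions (w₁ + p • w₂) w₂ e f using 1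
  funext x
  simp [bil_add_smul x.symm]

theorem inv_s_mul_minor_inv_mem_globalSolutions (w₁ w₂ : Fin n → ℂ) (a b : ℕ) :
    (fun x => x.s⁻¹ * (bil x.T⁻¹ w₁ w₁ ^ a *
      (bil x.T⁻¹ w₁ w₁ * bil x.T⁻¹ w₂ w₂ - bil x.T⁻¹ w₁ w₂ * bil x.T⁻¹ w₁ w₂) ^ b)) ∈
      globalSolutions n := by
  refine pow_mul_det_pow_mem_of_rankOne_pow_mem (globalSolutions n) (fun x => x.s⁻¹)
    (fun x => bil x.T⁻¹ w₁ w₁) (fun x => bil x.T⁻¹ w₁ w₂) (fun x => bil x.T⁻¹ w₂ w₂)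
    (fun p e f => ?_) a b
  convert inv_s_mul_bil_inv_pow_mem_globalSolutions (w₁ + p • w₂) w₂ e f using 1
  funext x
  have hsymm : (x.T⁻¹)ᵀ = x.T⁻¹ := by rw [Matrix.transpose_nonsing_inv, x.symm]
  simp [bil_add_smul hsymm]

end Solutions

/-! ### Radon transforms are not constant along the fibres -/

section Radon

open MeasureTheory

variable {n : ℕ}

/-- For symmetric unitary `T` one has `T T̄ = 1`, so `v ↦ T v̄` is an antilinear involution. The
Lagrangian directions form its `+1` eigenspace and the fibre its `-1` eigenspace. -/
theorem LagCover.T_mulVec_star_mulVec_star (x : LagCover n) (v : Fin n → ℂ) :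
    x.T *ᵥ star (x.T *ᵥ star v) = v := by
  have h : x.T * x.Tᴴ = 1 := Matrix.mem_unitaryGroup_iff.1 x.unitary
  have h2 : star (x.T *ᵥ star v) = x.Tᴴ *ᵥ v := by
    have hc : (x.Tᴴ)ᵀ = x.Tᴴ := by
      ext i j
      simpa using congrArg star (congrFun (congrFun x.symm j) i)
    rw [Matrix.star_mulVec, star_star, ← Matrix.mulVec_transpose, hc]
  rw [h2, Matrix.mulVec_mulVec, h, Matrix.one_mulVec]

/-- The vectors `v - T v̄` lie in the fibre. If all were zero, the antilinear involution would be
the identity, which fails on `v` and `iv`. -/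
theorem LagCover.exists_fibre_ne_zero (hn : 0 < n) (x : LagCover n) :
    ∃ σ : Fin n → ℂ, σ ≠ 0 ∧ σ = -(x.T *ᵥ star σ) := by
  have hmem : ∀ v : Fin n → ℂ, v - x.T *ᵥ star v = -(x.T *ᵥ star (v - x.T *ᵥ star v)) := by
    intro v
    rw [star_sub, Matrix.mulVec_sub, x.T_mulVec_star_mulVec_star, neg_sub]
  by_contra! hcon
  have h0 : ∀ v : Fin n → ℂ, v = x.T *ᵥ star v := by
    intro v
    by_contra hv
    exact hcon _ (sub_ne_zero.2 hv) (hmem v)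
  set v : Fin n → ℂ := fun _ => 1
  have h1 := h0 v
  have h2 := h0 (Complex.I • v)
  rw [star_smul, Matrix.mulVec_smul, ← h1] at h2
  have h3 := congrFun h2 ⟨0, hn⟩
  simp [v] at h3
  have := congrArg Complex.im h3
  norm_num at this

/-- The two eigenspaces are orthogonal: the Hermitian product of `w` and `σ` is purely imaginary. -/
theorem inner_eq_zero_of_mem_lagDir (x : LagCover n) {σ : Fin n → ℂ}
    (hσ : σ = -(x.T *ᵥ star σ)) (w : lagDir x.T) :
    inner ℝ (WithLp.toLp 2 σ) (w : EuclideanSpace ℂ (Fin n)) = 0 := by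
  have hw : (w : EuclideanSpace ℂ (Fin n)).ofLp = x.T *ᵥ star (w : EuclideanSpace ℂ (Fin n)).ofLp :=
    w.2
  set h := (w : EuclideanSpace ℂ (Fin n)).ofLp with hh
  have key : h ⬝ᵥ star σ = -star (h ⬝ᵥ star σ) := by
    calc h ⬝ᵥ star σ = (x.T *ᵥ star h) ⬝ᵥ star σ := by rw [← hw]
      _ = star h ⬝ᵥ (x.T *ᵥ star σ) := by
          rw [Matrix.dotProduct_mulVec, ← Matrix.mulVec_transpose, x.symm]
      _ = -(star h ⬝ᵥ σ) := by rw [eq_neg_iff_add_eq_zero, ← dotProduct_add]; nth_rw 2 [hσ]; simp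
      _ = -star (h ⬝ᵥ star σ) := by rw [Matrix.star_dotProduct, dotProduct_comm]
  have h1 : inner ℝ (WithLp.toLp 2 σ) (w : EuclideanSpace ℂ (Fin n)) = (h ⬝ᵥ star σ).re := by
    rw [PiLp.inner_apply, dotProduct, Complex.re_sum]
    refine Finset.sum_congr rfl fun i _ => ?_
    simp [Complex.inner, h]
  rw [h1]
  have := congrArg Complex.re key
  simp at this
  linarith

/-- The shift `kσ/2` is orthogonal to the plane of integration. By Pythagoras the argument of `φ`
has norm at least `‖w‖`, which gives an integrable bound, and at least `k‖σ‖/2`, which gives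
pointwise decay. -/
theorem radonComp_smul_tendsto_zero (φ : 𝓢(EuclideanSpace ℂ (Fin n), ℂ)) (x : LagCover n)
    {σ : Fin n → ℂ} (hσ0 : σ ≠ 0) (hσ : σ = -(x.T *ᵥ star σ)) :
    Filter.Tendsto (fun k : ℕ => radonComp φ x.T ((k : ℂ) • σ)) Filter.atTop (nhds 0) := by
  -- `(1 + ‖w‖)^(-d)` is integrable once `d` exceeds the dimension.
  set d := Module.finrank ℝ (lagDir x.T) + 1 with hd
  obtain ⟨C, hC0, hC⟩ : ∃ C, 0 < C ∧ ∀ y, (1 + ‖y‖) ^ d * ‖φ y‖ ≤ C := by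
    obtain ⟨C, hC⟩ : ∃ C, ∀ y, (1 + ‖y‖) ^ d * ‖iteratedFDeriv ℝ 0 φ y‖ ≤ C :=
      ⟨_, SchwartzMap.one_add_le_sup_seminorm_apply (𝕜 := ℝ) (m := (d, 0)) le_rfl le_rfl φ⟩
    refine ⟨max C 1, by positivity, fun y => le_max_of_le_left ?_⟩
    simpa using hC y
  have hnorm : ∀ (k : ℕ) (w : lagDir x.T),
      ‖w‖ ≤ ‖WithLp.toLp 2 ((1 / 2 : ℂ) • (k : ℂ) • σ) + (w : EuclideanSpace ℂ (Fin n))‖ ∧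
      k * (‖WithLp.toLp 2 σ‖ / 2) ≤
        ‖WithLp.toLp 2 ((1 / 2 : ℂ) • (k : ℂ) • σ) + (w : EuclideanSpace ℂ (Fin n))‖ := by
    intro k w
    have heq : WithLp.toLp 2 ((1 / 2 : ℂ) • (k : ℂ) • σ) = ((k / 2 : ℝ)) • WithLp.toLp 2 σ := by
      ext i
      simp
      ring
    have horth : inner ℝ (((k / 2 : ℝ)) • WithLp.toLp 2 σ) (w : EuclideanSpace ℂ (Fin n)) = 0 := by
      rw [real_inner_smul_left, inner_eq_zero_of_mem_lagDir x hσ w, mul_zero]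
    have hpyth := norm_add_sq_eq_norm_sq_add_norm_sq_of_inner_eq_zero _ _ horth
    rw [heq]
    have hns : ‖((k / 2 : ℝ)) • WithLp.toLp 2 σ‖ = k * (‖WithLp.toLp 2 σ‖ / 2) := by
      rw [norm_smul, Real.norm_of_nonneg (by positivity)]; ring
    constructor
    · refine (sq_le_sq₀ (by positivity) (norm_nonneg _)).1 ?_
      rw [sq, sq, hpyth]
      have : ‖w‖ = ‖(w : EuclideanSpace ℂ (Fin n))‖ := rfl
      rw [this]
      nlinarith [mul_self_nonneg ‖((k / 2 : ℝ)) • WithLp.toLp 2 σ‖]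
    · rw [← hns]
      refine (sq_le_sq₀ (by positivity) (norm_nonneg _)).1 ?_
      rw [sq, sq, hpyth]
      nlinarith [mul_self_nonneg ‖(w : EuclideanSpace ℂ (Fin n))‖]
  have hσn : 0 < ‖WithLp.toLp 2 σ‖ := by
    rw [norm_pos_iff]
    exact fun h => hσ0 (congrArg WithLp.ofLp h)
  have hbound : Integrable (fun w : lagDir x.T => C * (1 + ‖w‖) ^ (-(d : ℝ))) :=
    (integrable_one_add_norm (by rw [hd]; push_cast; linarith)).const_mul C
  rw [show (0 : ℂ) = ∫ _ : lagDir x.T, (0 : ℂ) by simp]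
  refine tendsto_integral_of_dominated_convergence _ (fun k => ?_) hbound
    (fun k => Filter.Eventually.of_forall fun w => ?_) (Filter.Eventually.of_forall fun w => ?_)
  · exact Continuous.aestronglyMeasurable (by fun_prop)
  · set y := WithLp.toLp 2 ((1 / 2 : ℂ) • (k : ℂ) • σ) + (w : EuclideanSpace ℂ (Fin n))
    have h1 := hC y
    have h2 := (hnorm k w).1
    have h3 : (1 + ‖w‖) ^ d * ‖φ y‖ ≤ C :=
      le_trans (by gcongr) h1
    rw [Real.rpow_neg (by positivity), Real.rpow_natCast, ← div_eq_mul_inv,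
      le_div_iff₀ (by positivity), mul_comm]
    exact h3
  · refine φ.tendsto_cocompact.comp ?_
    rw [← Metric.cobounded_eq_cocompact, ← tendsto_norm_atTop_iff_cobounded]
    refine Filter.tendsto_atTop_mono (fun k => (hnorm k w).2) ?_
    exact tendsto_natCast_atTop_atTop.atTop_mul_const (by positivity)

theorem eq_zero_of_isRadonTransform_constOnFibres (hn : 0 < n) {f : LagCover n → ℂ}
    (hf : IsRadonTransform (constOnFibres f)) : f = 0 := by
  obtain ⟨φ, hφ⟩ := hf
  funext x
  obtain ⟨σ, hσ0, hσ⟩ := x.exists_fibre_ne_zero hn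
  have hk : ∀ k : ℕ, (k : ℂ) • σ = -(x.T *ᵥ star ((k : ℂ) • σ)) := by
    intro k
    rw [star_smul, Matrix.mulVec_smul, ← smul_neg, ← hσ]
    simp
  have hconst : ∀ k : ℕ, radonComp φ x.T ((k : ℂ) • σ) = f x := fun k =>
    (hφ ⟨(x, (k : ℂ) • σ), hk k⟩).symm
  have := radonComp_smul_tendsto_zero φ x hσ0 hσ
  simp only [hconst] at this
  exact tendsto_nhds_unique tendsto_const_nhds this

end Radon

/-! ### Weights -/

section Weights

variable {n : ℕ}

theorem WeightLE.refl (μ : Fin n → ℤ) : WeightLE μ μ := ⟨fun _ => le_rfl, rfl⟩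

theorem WeightLE.add {μ μ' m m' : Fin n → ℤ} (h : WeightLE μ m) (h' : WeightLE μ' m') :
    WeightLE (μ + μ') (m + m') := by
  refine ⟨fun k => ?_, ?_⟩
  · simp only [Pi.add_apply, Finset.sum_add_distrib]
    exact add_le_add (h.1 k) (h'.1 k)
  · simp only [Pi.add_apply, Finset.sum_add_distrib, h.2, h'.2]

theorem eq_of_forall_partial_sum_eq {μ m : Fin n → ℤ}
    (h : ∀ k : ℕ, ∑ i with i.val < k, μ i = ∑ i with i.val < k, m i) : μ = m := by
  funext j
  have key : ∀ ν : Fin n → ℤ,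
      ∑ i with i.val < j.val + 1, ν i = ν j + ∑ i with i.val < j.val, ν i := by
    intro ν
    rw [← Finset.sum_insert (by simp)]
    refine Finset.sum_congr ?_ fun _ _ => rfl
    ext i
    simp [Fin.ext_iff]
    omega
  have := h (j.val + 1)
  rw [key, key, h j.val] at this
  exact add_right_cancel this

/-- Inequalities between partial sums that add up to equalities are equalities. Hence the top weight
of a product comes only from the top weights of its factors. -/
theorem WeightLE.eq_of_add_eq {μ μ' m m' : Fin n → ℤ} (h : WeightLE μ m) (h' : WeightLE μ' m')
    (heq : μ + μ' = m + m') : μ = m := by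
  refine eq_of_forall_partial_sum_eq fun k => ?_
  have h1 := h.1 k
  have h2 := h'.1 k
  have h3 : ∑ i with i.val < k, (μ + μ') i = ∑ i with i.val < k, (m + m') i := by rw [heq]
  simp only [Pi.add_apply, Finset.sum_add_distrib] at h3
  linarith

/-- The character of the diagonal torus with weight `μ`. -/
def torusChar (μ : Fin n → ℤ) (z : Fin n → Circle) : ℂ := ∏ i, (z i : ℂ) ^ μ i

theorem torusChar_add (μ ν : Fin n → ℤ) (z : Fin n → Circle) :
    torusChar (μ + ν) z = torusChar μ z * torusChar ν z := by
  simp only [torusChar, Pi.add_apply, ← Finset.prod_mul_distrib]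
  exact Finset.prod_congr rfl fun i _ => zpow_add₀ (Circle.coe_ne_zero _) _ _

theorem torusChar_single (i : Fin n) (κ : ℤ) (z : Fin n → Circle) :
    torusChar (Pi.single i κ) z = (z i : ℂ) ^ κ := by
  rw [torusChar, Finset.prod_eq_single i]
  · simp
  · intro j _ hj
    simp [hj]
  · simp

theorem norm_torusChar (μ : Fin n → ℤ) (z : Fin n → Circle) : ‖torusChar μ z‖ = 1 := by
  simp [torusChar, norm_prod, Circle.norm_coe]

theorem torusChar_ne_zero (μ : Fin n → ℤ) (z : Fin n → Circle) : torusChar μ z ≠ 0 :=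
  norm_ne_zero_iff.1 (by rw [norm_torusChar]; exact one_ne_zero)

theorem exists_torusChar_ne {μ ν : Fin n → ℤ} (h : μ ≠ ν) : ∃ z, torusChar μ z ≠ torusChar ν z := by
  obtain ⟨i, hi⟩ := Function.ne_iff.1 h
  have hk : ((μ i - ν i : ℤ) : ℝ) ≠ 0 := by exact_mod_cast sub_ne_zero.2 hi
  -- Chosen so that the ratio of the two characters at `w` in the `i`-th place is `exp(iπ) = -1`.
  set w : Circle := Circle.exp (Real.pi / (μ i - ν i : ℤ)) with hw
  have hw1 : (w : ℂ) ^ (μ i - ν i) = -1 := by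
    rw [hw, Circle.coe_exp, ← Complex.exp_int_mul, ← Complex.exp_pi_mul_I]
    congr 1
    have hk' : ((μ i - ν i : ℤ) : ℂ) ≠ 0 := by exact_mod_cast sub_ne_zero.2 hi
    push_cast at hk' ⊢
    field_simp
  have hchar : ∀ κ : Fin n → ℤ, torusChar κ (Function.update 1 i w) = (w : ℂ) ^ κ i := by
    intro κ
    rw [torusChar, Finset.prod_eq_single i]
    · simp
    · intro j _ hj
      simp [Function.update_of_ne hj]
    · simp
  refine ⟨Function.update 1 i w, fun heq => ?_⟩
  rw [hchar, hchar] at heq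
  rw [zpow_sub₀ (Circle.coe_ne_zero _), heq, div_self (zpow_ne_zero _ (Circle.coe_ne_zero _))] at hw1
  norm_num at hw1

/-- The functions of weight `μ` on the double cover that are continuous along the orbits. -/
def weightSpace (μ : Fin n → ℤ) : Submodule ℂ (LagCover n → ℂ) where
  carrier := {f | (∀ x : LagCover n, Continuous fun u => f (x.act u)) ∧
    ∀ z, coverRep n (diagU z) f = torusChar μ z • f}
  zero_mem' := ⟨fun _ => continuous_const, fun z => by simp⟩
  add_mem' := fun ha hb => ⟨fun x => (ha.1 x).add (hb.1 x), fun z => by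
    rw [map_add, ha.2, hb.2, smul_add]⟩
  smul_mem' := fun c f ha => ⟨fun x => (ha.1 x).const_smul c, fun z => by
    rw [map_smul, ha.2, smul_comm]⟩

theorem coverRep_mul (u : Matrix.unitaryGroup (Fin n) ℂ) (f g : LagCover n → ℂ) :
    coverRep n u (f * g) = coverRep n u f * coverRep n u g := rfl

theorem mul_mem_weightSpace {μ ν : Fin n → ℤ} {f g : LagCover n → ℂ} (hf : f ∈ weightSpace μ)
    (hg : g ∈ weightSpace ν) : f * g ∈ weightSpace (μ + ν) :=
  ⟨fun x => (hf.1 x).mul (hg.1 x), fun z => by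
    rw [coverRep_mul, hf.2, hg.2, torusChar_add, smul_mul_smul_comm]⟩

/-- The sum of the weight spaces for the weights with property `P`. -/
def weightSum (P : (Fin n → ℤ) → Prop) : Submodule ℂ (LagCover n → ℂ) :=
  ⨆ ν : {ν // P ν}, weightSpace ν.1

theorem weightSpace_le_weightSum {P : (Fin n → ℤ) → Prop} {μ : Fin n → ℤ} (h : P μ) :
    weightSpace μ ≤ weightSum P :=
  le_iSup (fun ν : {ν // P ν} => weightSpace ν.1) ⟨μ, h⟩

theorem mem_weightSum {P : (Fin n → ℤ) → Prop} {μ : Fin n → ℤ} (h : P μ) {f : LagCover n → ℂ}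
    (hf : f ∈ weightSpace μ) : f ∈ weightSum P :=
  weightSpace_le_weightSum h hf

theorem weightSum_mono {P Q : (Fin n → ℤ) → Prop} (h : ∀ ν, P ν → Q ν) :
    weightSum P ≤ weightSum Q :=
  iSup_le fun ν => weightSpace_le_weightSum (h ν.1 ν.2)

theorem mul_mem_weightSum {P Q R : (Fin n → ℤ) → Prop} (h : ∀ μ ν, P μ → Q ν → R (μ + ν))
    {f g : LagCover n → ℂ} (hf : f ∈ weightSum P) (hg : g ∈ weightSum Q) :
    f * g ∈ weightSum R := by
  refine Submodule.iSup_induction _ (motive := fun f => f * g ∈ weightSum R) hf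
    (fun μ f hf => ?_) (by simp) (fun a b ha hb => by rw [add_mul]; exact add_mem ha hb)
  refine Submodule.iSup_induction _ (motive := fun g => f * g ∈ weightSum R) hg
    (fun ν g hg => ?_) (by simp) (fun a b ha hb => by rw [mul_add]; exact add_mem ha hb)
  exact weightSpace_le_weightSum (h _ _ μ.2 ν.2) (mul_mem_weightSpace hf hg)

theorem continuous_of_mem_weightSum {P : (Fin n → ℤ) → Prop} {f : LagCover n → ℂ}
    (hf : f ∈ weightSum P) (x : LagCover n) : Continuous fun u => f (x.act u) :=
  Submodule.iSup_induction _ (motive := fun f => Continuous fun u => f (x.act u)) hf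
    (fun _ _ hf => hf.1 x) continuous_const (fun _ _ ha hb => ha.add hb)

/-- A subspace stable under the torus contains the component of given weight of each of its
elements. -/
theorem mem_of_add_mem_of_weight (W : Submodule ℂ (LagCover n → ℂ))
    (hW : ∀ z, ∀ f ∈ W, coverRep n (diagU z) f ∈ W) {P : (Fin n → ℤ) → Prop} {μ : Fin n → ℤ}
    (hμ : ¬ P μ) {f l : LagCover n → ℂ} (hf : f ∈ weightSpace μ) (hl : l ∈ weightSum P)
    (h : f + l ∈ W) : f ∈ W := by
  obtain ⟨s, hs⟩ := (Submodule.mem_iSup_iff_exists_finset).1 hl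
  clear hl
  induction s using Finset.induction_on generalizing f l with
  | empty =>
    simp only [Finset.notMem_empty, iSup_false, iSup_bot, Submodule.mem_bot] at hs
    rwa [hs, add_zero] at h
  | insert ν s _ ih =>
    rw [Finset.iSup_insert] at hs
    obtain ⟨a, ha, b, hb, rfl⟩ := Submodule.mem_sup.1 hs
    have hne : ν.1 ≠ μ := fun h => hμ (h ▸ ν.2)
    obtain ⟨z, hz⟩ := exists_torusChar_ne hne
    -- The operator `ρ(z) - χ_ν(z)` kills the component `a` of weight `ν`, multiplies `f` by a
    -- nonzero number and preserves the other weight spaces.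
    have hmem : coverRep n (diagU z) (f + (a + b)) - torusChar ν.1 z • (f + (a + b)) ∈ W :=
      W.sub_mem (hW z _ h) (W.smul_mem _ h)
    have hinv : coverRep n (diagU z) b ∈ ⨆ i ∈ s, weightSpace (i : {ν // P ν}).1 := by
      have hle : (⨆ i ∈ s, weightSpace (i : {ν // P ν}).1) ≤
          (⨆ i ∈ s, weightSpace (i : {ν // P ν}).1).comap (coverRep n (diagU z)) := by
        refine iSup₂_le fun i hi g hg => ?_
        rw [Submodule.mem_comap, hg.2]
        exact Submodule.smul_mem _ _ (Submodule.mem_iSup_of_mem i (Submodule.mem_iSup_of_mem hi hg))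
      exact hle hb
    have heq : coverRep n (diagU z) (f + (a + b)) - torusChar ν.1 z • (f + (a + b)) =
        (torusChar μ z - torusChar ν.1 z) • f +
          (coverRep n (diagU z) b - torusChar ν.1 z • b) := by
      rw [map_add, map_add, hf.2, ha.2]
      module
    rw [heq] at hmem
    have := ih ((weightSpace μ).smul_mem _ hf) hmem
      (Submodule.sub_mem _ hinv (Submodule.smul_mem _ _ hb))
    have h2 := W.smul_mem (torusChar μ z - torusChar ν.1 z)⁻¹ this
    rwa [smul_smul, inv_mul_cancel₀ (sub_ne_zero.2 hz.symm), one_smul] at h2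

end Weights

/-! ### Invariant integration -/

section Integration

variable {n : ℕ}

open MeasureTheory

instance compactSpace_unitaryGroup : CompactSpace (Matrix.unitaryGroup (Fin n) ℂ) := by
  refine (isCompact_iff_compactSpace
    (s := ((Matrix.unitaryGroup (Fin n) ℂ : Submonoid _) : Set (Matrix (Fin n) (Fin n) ℂ)))).1 ?_
  have hK : IsCompact {A : Matrix (Fin n) (Fin n) ℂ | ∀ i j, A i j ∈ Metric.closedBall (0 : ℂ) 1} := by
    have := isCompact_univ_pi fun _ : Fin n => isCompact_univ_pi fun _ : Fin n =>
      isCompact_closedBall (0 : ℂ) 1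
    convert! this using 1
    ext A
    exact ⟨fun h i _ j _ => h i j, fun h i j => h i trivial j trivial⟩
  refine hK.of_isClosed_subset ?_ fun A hA i j => ?_
  · have : ((Matrix.unitaryGroup (Fin n) ℂ : Submonoid _) : Set (Matrix (Fin n) (Fin n) ℂ)) =
        {A | A * star A = 1} := by
      ext A; exact Matrix.mem_unitaryGroup_iff
    rw [this]
    exact isClosed_eq (by fun_prop) continuous_const
  · simpa using entry_norm_bound_of_unitary hA i j

/-- The Borel `σ`-algebra of `U(n)`. -/
local instance measurableSpace_unitaryGroup : MeasurableSpace (Matrix.unitaryGroup (Fin n) ℂ) :=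
  borel _

local instance borelSpace_unitaryGroup : BorelSpace (Matrix.unitaryGroup (Fin n) ℂ) := ⟨rfl⟩

/-- The invariant `L²` pairing of the restrictions of `f` and `g` to the orbit of `x`. -/
def orbitPairing (x : LagCover n) (f g : LagCover n → ℂ) : ℂ :=
  ∫ u : Matrix.unitaryGroup (Fin n) ℂ, star (f (x.act u⁻¹)) * g (x.act u⁻¹) ∂Measure.haar

theorem LagCover.act_mul (x : LagCover n) (u v : Matrix.unitaryGroup (Fin n) ℂ) :
    x.act (u * v) = (x.act u).act v := by
  ext1
  · simp [LagCover.act, Matrix.mul_assoc]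
  · simp [LagCover.act, Matrix.det_mul]; ring

theorem LagCover.act_one (x : LagCover n) : x.act 1 = x := by
  ext <;> simp [LagCover.act]

/-- The inverse in `orbitPairing` turns translation by `v` into left multiplication of the
integration variable, so left invariance of Haar measure applies. -/
theorem orbitPairing_coverRep (x : LagCover n) (v : Matrix.unitaryGroup (Fin n) ℂ)
    (f g : LagCover n → ℂ) :
    orbitPairing x (coverRep n v f) (coverRep n v g) = orbitPairing x f g := by
  have h : ∀ f : LagCover n → ℂ, ∀ u, coverRep n v f (x.act u⁻¹) = f (x.act (v⁻¹ * u)⁻¹) := by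
    intro f u
    rw [mul_inv_rev, inv_inv, LagCover.act_mul]
    rfl
  simp only [orbitPairing, h]
  exact integral_mul_left_eq_self (μ := Measure.haar)
    (fun u => star (f (x.act u⁻¹)) * g (x.act u⁻¹)) v⁻¹

theorem integrable_orbitPairing {x : LagCover n} {f g : LagCover n → ℂ}
    (hf : Continuous fun u => f (x.act u)) (hg : Continuous fun u => g (x.act u)) :
    Integrable (fun u : Matrix.unitaryGroup (Fin n) ℂ => star (f (x.act u⁻¹)) * g (x.act u⁻¹))
      Measure.haar := by
  have h1 : Continuous fun u => f (x.act u⁻¹) := hf.comp continuous_inv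
  have h2 : Continuous fun u => g (x.act u⁻¹) := hg.comp continuous_inv
  exact (h1.star.mul h2).integrable_of_hasCompactSupport (HasCompactSupport.of_compactSpace _)

theorem orbitPairing_add_left {x : LagCover n} {f f' g : LagCover n → ℂ}
    (hf : Continuous fun u => f (x.act u)) (hf' : Continuous fun u => f' (x.act u))
    (hg : Continuous fun u => g (x.act u)) :
    orbitPairing x (f + f') g = orbitPairing x f g + orbitPairing x f' g := by
  rw [orbitPairing, orbitPairing, orbitPairing, ← integral_add (integrable_orbitPairing hf hg)
    (integrable_orbitPairing hf' hg)]
  simp [add_mul]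

theorem orbitPairing_add_right {x : LagCover n} {f g g' : LagCover n → ℂ}
    (hf : Continuous fun u => f (x.act u)) (hg : Continuous fun u => g (x.act u))
    (hg' : Continuous fun u => g' (x.act u)) :
    orbitPairing x f (g + g') = orbitPairing x f g + orbitPairing x f g' := by
  rw [orbitPairing, orbitPairing, orbitPairing, ← integral_add (integrable_orbitPairing hf hg)
    (integrable_orbitPairing hf hg')]
  simp [mul_add]

theorem orbitPairing_smul_smul (x : LagCover n) (a b : ℂ) (f g : LagCover n → ℂ) :
    orbitPairing x (a • f) (b • g) = star a * b * orbitPairing x f g := by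
  rw [orbitPairing, orbitPairing, ← integral_const_mul]
  congr 1
  funext u
  simp
  ring

/-- Invariance under the torus multiplies the pairing by `χ̄_μ χ_ν`, which differs from 1 at some
`z`. -/
theorem orbitPairing_eq_zero_of_weight (x : LagCover n) {μ ν : Fin n → ℤ} (h : μ ≠ ν)
    {f g : LagCover n → ℂ} (hf : f ∈ weightSpace μ) (hg : g ∈ weightSpace ν) :
    orbitPairing x f g = 0 := by
  obtain ⟨z, hz⟩ := exists_torusChar_ne h
  have h1 := orbitPairing_coverRep x (diagU z) f g
  rw [hf.2, hg.2, orbitPairing_smul_smul] at h1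
  have h2 : star (torusChar μ z) * torusChar μ z = 1 := by
    rw [Complex.star_def, Complex.conj_mul', norm_torusChar]; simp
  by_contra h0
  have h3 : star (torusChar μ z) * torusChar ν z = 1 := by
    have : (star (torusChar μ z) * torusChar ν z - 1) * orbitPairing x f g = 0 := by
      rw [sub_mul, h1, one_mul, sub_self]
    exact sub_eq_zero.1 ((mul_eq_zero.1 this).resolve_right h0)
  exact hz (mul_left_cancel₀ (star_ne_zero.2 (torusChar_ne_zero μ z)) (h2.trans h3.symm))

theorem eq_zero_of_orbitPairing_self {x : LagCover n} {f : LagCover n → ℂ}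
    (hf : Continuous fun u => f (x.act u)) (h : orbitPairing x f f = 0) : f x = 0 := by
  have hc : Continuous fun u => f (x.act u⁻¹) := hf.comp continuous_inv
  have h1 : orbitPairing x f f =
      ((∫ u : Matrix.unitaryGroup (Fin n) ℂ, ‖f (x.act u⁻¹)‖ ^ 2 ∂Measure.haar : ℝ) : ℂ) := by
    rw [orbitPairing, ← integral_complex_ofReal]
    congr 1
    funext u
    rw [Complex.star_def, Complex.conj_mul']
    simp
  rw [h1, Complex.ofReal_eq_zero] at h
  have hc2 : Continuous fun u => ‖f (x.act u⁻¹)‖ ^ 2 := hc.norm.pow 2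
  rw [integral_eq_zero_iff_of_nonneg (fun u => by positivity)
    (hc2.integrable_of_hasCompactSupport (HasCompactSupport.of_compactSpace _))] at h
  have h2 := Measure.eq_of_ae_eq h hc2 continuous_const
  have h3 := congrFun h2 1
  simpa [LagCover.act_one] using h3

end Integration

/-! ### Representations generated by highest weight functions -/

section HighestWeight

variable {n : ℕ}

/-- The weights strictly below `m` in the dominance order. -/
def WeightLT (m ν : Fin n → ℤ) : Prop := WeightLE ν m ∧ ν ≠ m

/-- `h` has weight `m`, its translates span a finite-dimensional space, and every translate of `h`
is the sum of a multiple of `h` and functions of lower weights. -/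
structure IsHighestWeightFunction (h : LagCover n → ℂ) (m : Fin n → ℤ) : Prop where
  weight : h ∈ weightSpace m
  lower : ∀ u, coverRep n u h ∈ Submodule.span ℂ {h} ⊔ weightSum (WeightLT m)
  finite : ∃ M : Submodule ℂ (LagCover n → ℂ), M.FG ∧ ∀ u, coverRep n u h ∈ M

/-- Translates multiply as `(c h + l)(c' h' + l')`, and every term except `c c' h h'` has strictly
lower weights. This reduces the generators to single entries, 2×2 minors and powers of `s`. -/
theorem IsHighestWeightFunction.mul {h h' : LagCover n → ℂ} {m m' : Fin n → ℤ}
    (H : IsHighestWeightFunction h m) (H' : IsHighestWeightFunction h' m') :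
    IsHighestWeightFunction (h * h') (m + m') := by
  refine ⟨mul_mem_weightSpace H.weight H'.weight, fun u => ?_, ?_⟩
  · obtain ⟨a, ha, l, hl, hal⟩ := Submodule.mem_sup.1 (H.lower u)
    obtain ⟨a', ha', l', hl', hal'⟩ := Submodule.mem_sup.1 (H'.lower u)
    obtain ⟨c, rfl⟩ := Submodule.mem_span_singleton.1 ha
    obtain ⟨c', rfl⟩ := Submodule.mem_span_singleton.1 ha'
    rw [coverRep_mul, ← hal, ← hal']
    have h1 : h ∈ weightSum (· = m) := weightSpace_le_weightSum (P := (· = m)) rfl H.weight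
    have h1' : h' ∈ weightSum (· = m') := weightSpace_le_weightSum (P := (· = m')) rfl H'.weight
    have p1 : h * l' ∈ weightSum (WeightLT (m + m')) :=
      mul_mem_weightSum (P := (· = m)) (Q := WeightLT m') (by
        rintro _ ν rfl hν
        exact ⟨(WeightLE.refl _).add hν.1, fun h => hν.2 (add_left_cancel h)⟩) h1 hl'
    have p2 : l * h' ∈ weightSum (WeightLT (m + m')) :=
      mul_mem_weightSum (P := WeightLT m) (Q := (· = m')) (by
        rintro ν _ hν rfl
        exact ⟨hν.1.add (WeightLE.refl _), fun h => hν.2 (add_right_cancel h)⟩) hl h1'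
    have p3 : l * l' ∈ weightSum (WeightLT (m + m')) :=
      mul_mem_weightSum (P := WeightLT m) (Q := WeightLT m') (fun μ ν hμ hν => ⟨hμ.1.add hν.1, fun h => hμ.2 (hμ.1.eq_of_add_eq hν.1 h)⟩)
        hl hl'
    refine Submodule.mem_sup.2 ⟨(c * c') • (h * h'),
      Submodule.smul_mem _ _ (Submodule.mem_span_singleton_self _),
      c • (h * l') + c' • (l * h') + l * l',
      add_mem (add_mem (Submodule.smul_mem _ _ p1) (Submodule.smul_mem _ _ p2)) p3, ?_⟩
    simp only [Algebra.smul_def, map_mul]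
    ring
  · obtain ⟨M, hM, hMu⟩ := H.finite
    obtain ⟨M', hM', hMu'⟩ := H'.finite
    exact ⟨M * M', hM.mul hM', fun u => Submodule.mul_mem_mul (hMu u) (hMu' u)⟩

theorem IsHighestWeightFunction.one : IsHighestWeightFunction (1 : LagCover n → ℂ) 0 := by
  refine ⟨⟨fun _ => continuous_const, fun z => ?_⟩,
    fun u => Submodule.mem_sup_left (Submodule.mem_span_singleton_self _),
    ⟨Submodule.span ℂ {1}, Submodule.fg_span (Set.finite_singleton _),
      fun u => Submodule.mem_span_singleton_self _⟩⟩
  have : torusChar (0 : Fin n → ℤ) z = 1 := by simp [torusChar]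
  rw [this, one_smul]
  rfl

theorem IsHighestWeightFunction.pow {h : LagCover n → ℂ} {m : Fin n → ℤ}
    (H : IsHighestWeightFunction h m) (k : ℕ) : IsHighestWeightFunction (h ^ k) (k • m) := by
  induction k with
  | zero => simpa using IsHighestWeightFunction.one
  | succ k ih => rw [pow_succ, succ_nsmul]; exact ih.mul H

/-- The representation generated by `h`. -/
def orbitSpan (h : LagCover n → ℂ) : Subrepresentation (coverRep n) where
  toSubmodule := Submodule.span ℂ (Set.range fun u => coverRep n u h)
  apply_mem_toSubmodule := by
    intro g v hv
    have hle : Submodule.span ℂ (Set.range fun u => coverRep n u h) ≤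
        (Submodule.span ℂ (Set.range fun u => coverRep n u h)).comap (coverRep n g) := by
      rw [Submodule.span_le]
      rintro _ ⟨u, rfl⟩
      refine Submodule.subset_span ⟨g * u, ?_⟩
      simp [map_mul]
    exact hle hv

theorem mem_orbitSpan_self (h : LagCover n → ℂ) : h ∈ (orbitSpan h).toSubmodule :=
  Submodule.subset_span ⟨1, by simp⟩

theorem orbitSpan_le {h : LagCover n → ℂ} {M : Submodule ℂ (LagCover n → ℂ)}
    (hM : ∀ u, coverRep n u h ∈ M) : (orbitSpan h).toSubmodule ≤ M := by
  refine Submodule.span_le.2 ?_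
  rintro _ ⟨u, rfl⟩
  exact hM u

/-- The dual of a finite-dimensional space of functions is spanned by the evaluations. -/
theorem dual_mem_span_eval {X : Type*} (V : Submodule ℂ (X → ℂ)) [FiniteDimensional ℂ V]
    (φ : Module.Dual ℂ V) :
    φ ∈ Submodule.span ℂ (Set.range fun x : X => (LinearMap.proj x : (X → ℂ) →ₗ[ℂ] ℂ) ∘ₗ V.subtype) := by
  set Φ := Submodule.span ℂ
    (Set.range fun x : X => (LinearMap.proj x : (X → ℂ) →ₗ[ℂ] ℂ) ∘ₗ V.subtype) with hΦ
  -- A function killed by all evaluations is zero; in finite dimension the double annihilator then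
  -- gives everything.
  have h0 : Φ.dualCoannihilator = ⊥ := by
    rw [Submodule.eq_bot_iff]
    intro v hv
    rw [Submodule.mem_dualCoannihilator] at hv
    ext x
    exact hv _ (Submodule.subset_span ⟨x, rfl⟩)
  have h1 : Φ = ⊤ := by
    rw [← Subspace.dualCoannihilator_dualAnnihilator_eq (W := Φ), h0,
      Submodule.dualAnnihilator_bot]
  rw [h1]
  trivial

/-- Functionals are combinations of evaluations, for which the coefficient is the function along an
orbit. -/
theorem continuous_matrixCoefficient (V : Subrepresentation (coverRep n))
    [FiniteDimensional ℂ V.toSubmodule]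
    (hV : ∀ f ∈ V.toSubmodule, ∀ x : LagCover n, Continuous fun u => f (x.act u))
    (v : V.toSubmodule) (φ : Module.Dual ℂ V.toSubmodule) :
    Continuous fun u => φ (V.toRepresentation u v) := by
  refine Submodule.span_induction (p := fun φ _ => Continuous fun u => φ (V.toRepresentation u v))
    ?_ continuous_const (fun a b _ _ ha hb => ha.add hb) (fun c a _ ha => ha.const_smul c)
    (dual_mem_span_eval V.toSubmodule φ)
  rintro _ ⟨x, rfl⟩
  exact hV v v.2 x

namespace IsHighestWeightFunction

variable {h : LagCover n → ℂ} {m : Fin n → ℤ}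

theorem orbitSpan_le_sup (H : IsHighestWeightFunction h m) :
    (orbitSpan h).toSubmodule ≤ Submodule.span ℂ {h} ⊔ weightSum (WeightLT m) :=
  orbitSpan_le H.lower

theorem orbitSpan_le_weightSum (H : IsHighestWeightFunction h m) :
    (orbitSpan h).toSubmodule ≤ weightSum fun ν => WeightLE ν m := by
  refine H.orbitSpan_le_sup.trans (sup_le ?_ (weightSum_mono fun ν hν => hν.1))
  rw [Submodule.span_singleton_le_iff_mem]
  exact weightSpace_le_weightSum (P := fun ν => WeightLE ν m) (WeightLE.refl m) H.weight

theorem continuous_of_mem (H : IsHighestWeightFunction h m) {f : LagCover n → ℂ}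
    (hf : f ∈ (orbitSpan h).toSubmodule) (x : LagCover n) : Continuous fun u => f (x.act u) :=
  continuous_of_mem_weightSum (H.orbitSpan_le_weightSum hf) x

theorem orbitPairing_eq_zero_of_lower (H : IsHighestWeightFunction h m) (x : LagCover n)
    {l : LagCover n → ℂ} (hl : l ∈ weightSum (WeightLT m)) : orbitPairing x l h = 0 := by
  suffices hs : orbitPairing x l h = 0 ∧ Continuous fun u => l (x.act u) from hs.1
  refine Submodule.iSup_induction _
    (motive := fun l => orbitPairing x l h = 0 ∧ Continuous fun u => l (x.act u)) hl
    (fun ν f hf => ⟨orbitPairing_eq_zero_of_weight x ν.2.2 hf H.weight, hf.1 x⟩) ?_ ?_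
  · refine ⟨?_, continuous_const⟩
    have := orbitPairing_smul_smul x 0 1 (0 : LagCover n → ℂ) h
    simpa using this
  · rintro a b ⟨ha, ha'⟩ ⟨hb, hb'⟩
    exact ⟨by rw [orbitPairing_add_left ha' hb' (H.weight.1 x), ha, hb, add_zero], ha'.add hb'⟩

/-- A nonzero invariant subspace of the representation generated by `h` contains `h`. -/
theorem mem_of_invariant (H : IsHighestWeightFunction h m) {W : Submodule ℂ (LagCover n → ℂ)}
    (hWV : W ≤ (orbitSpan h).toSubmodule) (hW : ∀ u, ∀ f ∈ W, coverRep n u f ∈ W)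
    (hne : W ≠ ⊥) : h ∈ W := by
  by_contra hh
  refine hne ((Submodule.eq_bot_iff _).2 fun F hF => ?_)
  -- A nonzero multiple of `h` in a translate of `F` could be isolated by its weight and would put
  -- `h` into `W`.
  have hlow : ∀ u, coverRep n u F ∈ weightSum (WeightLT m) := by
    intro u
    obtain ⟨a, ha, l, hl, hal⟩ := Submodule.mem_sup.1 (H.orbitSpan_le_sup (hWV (hW u F hF)))
    obtain ⟨c, rfl⟩ := Submodule.mem_span_singleton.1 ha
    have hc : c • h ∈ W := mem_of_add_mem_of_weight W (fun z f hf => hW _ f hf)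
      (P := WeightLT m) (fun h => h.2 rfl) (Submodule.smul_mem _ c H.weight) hl
      (by rw [hal]; exact hW u F hF)
    have hc0 : c = 0 := by
      by_contra hc0
      have := W.smul_mem c⁻¹ hc
      rw [smul_smul, inv_mul_cancel₀ hc0, one_smul] at this
      exact hh this
    rw [← hal, hc0, zero_smul, zero_add]
    exact hl
  funext x
  have hFc := H.continuous_of_mem (hWV hF) x
  refine eq_zero_of_orbitPairing_self hFc ?_
  -- `⟨F, ρ(u)h⟩ = ⟨ρ(u⁻¹)F, h⟩ = 0`, so `F` is orthogonal to the whole span; at the end `g = F`.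
  have key : ∀ g ∈ (orbitSpan h).toSubmodule,
      orbitPairing x F g = 0 ∧ Continuous fun u => g (x.act u) := by
    intro g hg
    refine Submodule.span_induction
      (p := fun g _ => orbitPairing x F g = 0 ∧ Continuous fun u => g (x.act u)) ?_ ?_ ?_ ?_ hg
    · rintro _ ⟨u, rfl⟩
      refine ⟨?_, H.continuous_of_mem (Submodule.subset_span ⟨u, rfl⟩) x⟩
      have := H.orbitPairing_eq_zero_of_lower x (hlow u⁻¹)
      rw [← orbitPairing_coverRep x u, ← Module.End.mul_apply, ← map_mul, mul_inv_cancel,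
        map_one] at this
      exact this
    · refine ⟨?_, continuous_const⟩
      simpa using orbitPairing_smul_smul x 1 0 F (0 : LagCover n → ℂ)
    · rintro a b _ _ ⟨ha, ha'⟩ ⟨hb, hb'⟩
      exact ⟨by rw [orbitPairing_add_right hFc ha' hb', ha, hb, add_zero], ha'.add hb'⟩
    · rintro c a _ ⟨ha, ha'⟩
      refine ⟨?_, ha'.const_smul c⟩
      have := orbitPairing_smul_smul x 1 c F a
      rwa [one_smul, ha, mul_zero] at this
  exact (key F (hWV hF)).1

theorem hasSignature (H : IsHighestWeightFunction h m) (h0 : h ≠ 0) (hm : Antitone m) :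
    HasSignature (orbitSpan h).toRepresentation m := by
  obtain ⟨M, hM, hMu⟩ := H.finite
  have : FiniteDimensional ℂ M := Module.Finite.iff_fg.2 hM
  have hfin : FiniteDimensional ℂ (orbitSpan h).toSubmodule :=
    Submodule.finiteDimensional_of_le (orbitSpan_le hMu)
  refine ⟨hm, hfin, continuous_matrixCoefficient _ fun f hf => H.continuous_of_mem hf, ?_,
    ⟨⟨h, mem_orbitSpan_self h⟩, fun h1 => h0 (congrArg Subtype.val h1),
      fun z => Subtype.ext (H.weight.2 z)⟩, ?_⟩
  · have hnt : Nontrivial (Subrepresentation (orbitSpan h).toRepresentation) := by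
      refine ⟨⊥, ⊤, fun h1 => h0 ?_⟩
      have h2 : (⟨h, mem_orbitSpan_self h⟩ : (orbitSpan h).toSubmodule) ∈
          (⊥ : Subrepresentation (orbitSpan h).toRepresentation) := by
        rw [h1]; exact Submodule.mem_top
      exact congrArg Subtype.val ((Submodule.mem_bot ℂ).1 h2)
    refine { hnt with eq_bot_or_eq_top := fun σ => ?_ }
    rw [or_iff_not_imp_left]
    intro hσ
    have hmem : h ∈ σ.toSubmodule.map (orbitSpan h).toSubmodule.subtype := by
      refine H.mem_of_invariant (Submodule.map_subtype_le _ _) ?_ ?_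
      · rintro u _ ⟨f, hf, rfl⟩
        exact ⟨_, σ.apply_mem_toSubmodule u hf, rfl⟩
      · intro h1
        exact hσ (Subrepresentation.toSubmodule_injective
          (Submodule.map_injective_of_injective (Submodule.injective_subtype _)
            (h1.trans (Submodule.map_bot _).symm)))
    refine Subrepresentation.toSubmodule_injective ?_
    change σ.toSubmodule = ⊤
    have hle : (orbitSpan h).toSubmodule ≤ σ.toSubmodule.map (orbitSpan h).toSubmodule.subtype := by
      refine orbitSpan_le fun u => ?_
      obtain ⟨f, hf, hfh⟩ := hmem
      exact ⟨_, σ.apply_mem_toSubmodule u hf, congrArg (coverRep n u) hfh⟩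
    rw [eq_top_iff]
    rintro ⟨f, hf⟩ -
    obtain ⟨g, hg, hgf⟩ := hle hf
    have : g = ⟨f, hf⟩ := Subtype.ext hgf
    exact this ▸ hg
  · rintro μ ⟨v, hv0, hv⟩
    by_contra hμ
    have hvm : v.1 ∈ weightSpace μ :=
      ⟨fun x => H.continuous_of_mem v.2 x, fun z => congrArg Subtype.val (hv z)⟩
    -- Applied to `v + (-v) = 0` with the zero subspace, isolating the weight `μ` shows `v = 0`.
    have hneg : -v.1 ∈ weightSum fun ν => WeightLE ν m :=
      Submodule.neg_mem _ (H.orbitSpan_le_weightSum v.2)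
    have := mem_of_add_mem_of_weight ⊥ (fun z f hf => by
      rw [(Submodule.mem_bot ℂ).1 hf, map_zero]; exact Submodule.zero_mem _)
      (P := fun ν => WeightLE ν m) hμ hvm hneg (by simp)
    exact hv0 (Subtype.ext ((Submodule.mem_bot ℂ).1 this))

end IsHighestWeightFunction

end HighestWeight

/-! ### Highest weight functions on the double cover -/

section Generators

variable {n : ℕ}

/-- `Z` is a symmetric matrix of functions on the double cover that transforms by
`Z ↦ g(u)ᵗ Z g(u)`, where the diagonal torus acts through the power `κ`. -/
structure IsEquivariantMatrix (Z : LagCover n → Matrix (Fin n) (Fin n) ℂ)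
    (g : Matrix.unitaryGroup (Fin n) ℂ → Matrix (Fin n) (Fin n) ℂ) (κ : ℤ) : Prop where
  symm : ∀ x, (Z x)ᵀ = Z x
  act : ∀ x u, Z (x.act u) = (g u)ᵀ * Z x * g u
  continuous : Continuous g
  diag : ∀ z, g (diagU z) = Matrix.diagonal fun i => (z i : ℂ) ^ κ
  ne_zero : κ ≠ 0

theorem isEquivariantMatrix_T :
    IsEquivariantMatrix (n := n) (fun x => x.T) (fun u => u) 1 where
  symm x := x.symm
  act _ _ := rfl
  continuous := continuous_subtype_val
  diag z := by simp [diagU]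
  ne_zero := one_ne_zero

/-- Since `u⁻¹` is the conjugate transpose, `T⁻¹` transforms like `T` with `u` replaced by its
conjugate; weights change sign. -/
theorem isEquivariantMatrix_inv :
    IsEquivariantMatrix (n := n) (fun x => x.T⁻¹) (fun u => (u : Matrix (Fin n) (Fin n) ℂ).map star)
      (-1) where
  symm x := by rw [Matrix.transpose_nonsing_inv, x.symm]
  act x u := by
    have hu : (u : Matrix (Fin n) (Fin n) ℂ)⁻¹ = (u : Matrix (Fin n) (Fin n) ℂ)ᴴ :=
      Matrix.inv_eq_right_inv (Matrix.mem_unitaryGroup_iff.1 u.2)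
    change ((u : Matrix (Fin n) (Fin n) ℂ)ᵀ * x.T * (u : Matrix (Fin n) (Fin n) ℂ))⁻¹ = _
    rw [Matrix.mul_inv_rev, Matrix.mul_inv_rev, ← Matrix.transpose_nonsing_inv, hu,
      ← Matrix.mul_assoc]
    rfl
  continuous := by
    have : Continuous fun u : Matrix.unitaryGroup (Fin n) ℂ => (u : Matrix (Fin n) (Fin n) ℂ) :=
      continuous_subtype_val
    exact this.matrix_map continuous_star
  diag z := by
    simp only [diagU]
    rw [Matrix.diagonal_map (star_zero ℂ)]
    congr 1
    funext i
    simp [← Circle.coe_inv_eq_conj]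
  ne_zero := by norm_num

theorem transpose_mul_mul_apply (M g : Matrix (Fin n) (Fin n) ℂ) (a b : Fin n) :
    (gᵀ * M * g) a b = bil M (fun i => g i a) (fun i => g i b) := by
  rw [bil, Matrix.mul_assoc, Matrix.mul_apply, dotProduct]
  rfl

theorem bil_eq_sum (M : Matrix (Fin n) (Fin n) ℂ) (a b : Fin n → ℂ) :
    bil M a b = ∑ i, ∑ j, a i * b j * M i j := by
  simp only [bil, dotProduct, Matrix.mulVec, Finset.mul_sum]
  exact Finset.sum_congr rfl fun i _ => Finset.sum_congr rfl fun j _ => by ring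

theorem sum_sum_mul_sum_sum {ι : Type*} [Fintype ι] (A B : ι → ι → ℂ) :
    (∑ i, ∑ j, A i j) * (∑ k, ∑ l, B k l) = ∑ i, ∑ j, ∑ k, ∑ l, A i j * B k l := by
  simp only [Finset.sum_mul]
  simp only [Finset.mul_sum]

theorem sum_sum_sum_rotate {ι : Type*} [Fintype ι] (f : ι → ι → ι → ℂ) :
    ∑ l, ∑ k, ∑ j, f l k j = ∑ j, ∑ k, ∑ l, f l k j := by
  calc _ = ∑ l, ∑ j, ∑ k, f l k j := Finset.sum_congr rfl fun l _ => Finset.sum_comm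
    _ = ∑ j, ∑ l, ∑ k, f l k j := Finset.sum_comm
    _ = _ := Finset.sum_congr rfl fun j _ => Finset.sum_comm

namespace IsEquivariantMatrix

variable {Z : LagCover n → Matrix (Fin n) (Fin n) ℂ}
  {g : Matrix.unitaryGroup (Fin n) ℂ → Matrix (Fin n) (Fin n) ℂ} {κ : ℤ}

theorem entry_mem_weightSpace (hZ : IsEquivariantMatrix Z g κ) (i j : Fin n) :
    (fun x => Z x i j) ∈ weightSpace (Pi.single i κ + Pi.single j κ) := by
  refine ⟨fun x => ?_, fun z => ?_⟩
  · simp only [hZ.act]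
    have h1 := hZ.continuous
    have h2 : Continuous fun u => (g u)ᵀ * Z x * g u :=
      (h1.matrix_transpose.matrix_mul continuous_const).matrix_mul h1
    exact h2.matrix_elem i j
  · funext x
    change Z (x.act (diagU z)) i j = _
    rw [hZ.act, hZ.diag, Matrix.diagonal_transpose, Matrix.mul_diagonal, Matrix.diagonal_mul,
      torusChar_add, torusChar_single, torusChar_single, Pi.smul_apply, smul_eq_mul]
    ring

theorem coverRep_entry (hZ : IsEquivariantMatrix Z g κ) (u : Matrix.unitaryGroup (Fin n) ℂ)
    (a b : Fin n) :
    coverRep n u (fun x => Z x a b) =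
      fun x => bil (Z x) (fun i => g u i a) (fun i => g u i b) := by
  funext x
  change Z (x.act u) a b = _
  rw [hZ.act, transpose_mul_mul_apply]

theorem coverRep_entry_eq_sum (hZ : IsEquivariantMatrix Z g κ)
    (u : Matrix.unitaryGroup (Fin n) ℂ) (a b : Fin n) :
    coverRep n u (fun x => Z x a b) = ∑ i, ∑ j, (g u i a * g u j b) • fun x => Z x i j := by
  rw [hZ.coverRep_entry]
  funext x
  simp [bil_eq_sum]

theorem finite_entry (hZ : IsEquivariantMatrix Z g κ) :
    ∃ M : Submodule ℂ (LagCover n → ℂ), M.FG ∧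
      ∀ a b u, coverRep n u (fun x => Z x a b) ∈ M := by
  refine ⟨Submodule.span ℂ (Set.range fun p : Fin n × Fin n => fun x => Z x p.1 p.2),
    Submodule.fg_span (Set.finite_range _), fun a b u => ?_⟩
  rw [hZ.coverRep_entry_eq_sum]
  exact Submodule.sum_mem _ fun i _ => Submodule.sum_mem _ fun j _ =>
    Submodule.smul_mem _ _ (Submodule.subset_span ⟨(i, j), rfl⟩)

/-- A translate is a combination of entries `Zᵢⱼ`, of weight `κ(eᵢ + eⱼ)`; the top weight occurs
only for `i = j = a`. -/
theorem isHighestWeightFunction_diag (hZ : IsEquivariantMatrix Z g κ) (a : Fin n)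
    (ha : ∀ i, WeightLE (Pi.single i κ) (Pi.single a κ : Fin n → ℤ)) :
    IsHighestWeightFunction (fun x => Z x a a) (Pi.single a κ + Pi.single a κ) := by
  refine ⟨hZ.entry_mem_weightSpace a a, fun u => ?_, ?_⟩
  · rw [hZ.coverRep_entry_eq_sum]
    refine Submodule.sum_mem _ fun i _ => Submodule.sum_mem _ fun j _ => Submodule.smul_mem _ _ ?_
    by_cases hij : (Pi.single i κ + Pi.single j κ : Fin n → ℤ) = Pi.single a κ + Pi.single a κ
    · have aux : ∀ i, (Pi.single i κ : Fin n → ℤ) = Pi.single a κ → i = a := by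
        intro i h
        by_contra hne
        have := congrFun h i
        simp only [Pi.single_eq_same, Pi.single_eq_of_ne hne] at this
        exact hZ.ne_zero this
      have h1 := aux i ((ha i).eq_of_add_eq (ha j) hij)
      have h2 := aux j ((ha j).eq_of_add_eq (ha i) (by rw [add_comm, hij]))
      subst h1; subst h2
      exact Submodule.mem_sup_left (Submodule.mem_span_singleton_self _)
    · have hlt : WeightLT (Pi.single a κ + Pi.single a κ) (Pi.single i κ + Pi.single j κ) :=
        ⟨(ha i).add (ha j), hij⟩
      exact Submodule.mem_sup_right (mem_weightSum hlt (hZ.entry_mem_weightSpace i j))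
  · obtain ⟨M, hM, hMu⟩ := hZ.finite_entry
    exact ⟨M, hM, hMu a a⟩

/-- The `2 × 2` minors of `Z`. -/
def minor (Z : LagCover n → Matrix (Fin n) (Fin n) ℂ) (i k j l : Fin n) : LagCover n → ℂ :=
  (fun x => Z x i j) * (fun x => Z x k l) - (fun x => Z x i l) * (fun x => Z x k j)

theorem minor_mem_weightSpace (hZ : IsEquivariantMatrix Z g κ) (i k j l : Fin n) :
    minor Z i k j l ∈ weightSpace
      ((Pi.single i κ + Pi.single k κ) + (Pi.single j κ + Pi.single l κ)) := by
  have h1 := mul_mem_weightSpace (hZ.entry_mem_weightSpace i j) (hZ.entry_mem_weightSpace k l)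
  have h2 := mul_mem_weightSpace (hZ.entry_mem_weightSpace i l) (hZ.entry_mem_weightSpace k j)
  rw [add_add_add_comm] at h1 h2
  rw [add_comm (Pi.single l κ : Fin n → ℤ)] at h2
  exact Submodule.sub_mem _ h1 h2

/-- Cauchy–Binet with unrestricted indices: rows `i, k` and columns `j, l`. -/
theorem coverRep_minor_eq_sum (hZ : IsEquivariantMatrix Z g κ)
    (u : Matrix.unitaryGroup (Fin n) ℂ) (a b : Fin n) :
    coverRep n u (minor Z a b a b) = ∑ i, ∑ j, ∑ k, ∑ l,
      (g u i a * g u j a * g u k b * g u l b) • minor Z i k j l := by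
  have e1 : ∀ x : LagCover n, bil (Z x) (fun i => g u i a) (fun i => g u i a) *
      bil (Z x) (fun i => g u i b) (fun i => g u i b) =
      ∑ i, ∑ j, ∑ k, ∑ l, (g u i a * g u j a * g u k b * g u l b) * (Z x i j * Z x k l) := by
    intro x
    rw [bil_eq_sum, bil_eq_sum, sum_sum_mul_sum_sum]
    refine Finset.sum_congr rfl fun i _ => Finset.sum_congr rfl fun j _ =>
      Finset.sum_congr rfl fun k _ => Finset.sum_congr rfl fun l _ => ?_
    ring
  have e2 : ∀ x : LagCover n, bil (Z x) (fun i => g u i a) (fun i => g u i b) *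
      bil (Z x) (fun i => g u i b) (fun i => g u i a) =
      ∑ i, ∑ j, ∑ k, ∑ l, (g u i a * g u j a * g u k b * g u l b) * (Z x i l * Z x k j) := by
    intro x
    rw [bil_eq_sum, bil_eq_sum, sum_sum_mul_sum_sum]
    refine Finset.sum_congr rfl fun i _ => ?_
    -- Exchanging the names `j` and `l` gives this product the same coefficients as in `e1`.
    rw [sum_sum_sum_rotate]
    refine Finset.sum_congr rfl fun j _ => Finset.sum_congr rfl fun k _ =>
      Finset.sum_congr rfl fun l _ => ?_
    ring
  rw [minor, map_sub, coverRep_mul, coverRep_mul, hZ.coverRep_entry, hZ.coverRep_entry,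
    hZ.coverRep_entry, hZ.coverRep_entry]
  funext x
  simp only [Pi.sub_apply, Pi.mul_apply, e1, e2, Finset.sum_apply, Pi.smul_apply, smul_eq_mul,
    minor, mul_sub, Finset.sum_sub_distrib]

/-- Minors with a repeated row or column vanish, so rows and columns each contribute at most the
weight of `{a, b}`. If both attain it, the minor is the given one up to sign. -/
theorem isHighestWeightFunction_minor (hZ : IsEquivariantMatrix Z g κ) {a b : Fin n} (hab : a ≠ b)
    (h : ∀ i k, i ≠ k → WeightLE (Pi.single i κ + Pi.single k κ)
      (Pi.single a κ + Pi.single b κ : Fin n → ℤ)) :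
    IsHighestWeightFunction (minor Z a b a b)
      ((Pi.single a κ + Pi.single b κ) + (Pi.single a κ + Pi.single b κ)) := by
  refine ⟨hZ.minor_mem_weightSpace a b a b, fun u => ?_, ?_⟩
  · rw [hZ.coverRep_minor_eq_sum]
    refine Submodule.sum_mem _ fun i _ => Submodule.sum_mem _ fun j _ => Submodule.sum_mem _ fun k _ =>
      Submodule.sum_mem _ fun l _ => Submodule.smul_mem _ _ ?_
    by_cases hik : i = k
    · have : minor Z i k j l = 0 := by subst hik; rw [minor, mul_comm, sub_self]
      rw [this]; exact Submodule.zero_mem _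
    by_cases hjl : j = l
    · have : minor Z i k j l = 0 := by subst hjl; rw [minor, sub_self]
      rw [this]; exact Submodule.zero_mem _
    by_cases hw : ((Pi.single i κ + Pi.single k κ) + (Pi.single j κ + Pi.single l κ) : Fin n → ℤ) =
        (Pi.single a κ + Pi.single b κ) + (Pi.single a κ + Pi.single b κ)
    · have aux : ∀ i k : Fin n, i ≠ k → (Pi.single i κ + Pi.single k κ : Fin n → ℤ) =
          Pi.single a κ + Pi.single b κ → (i = a ∧ k = b) ∨ (i = b ∧ k = a) := by
        intro i k hik heq
        have key : ∀ i k : Fin n, i ≠ k → (Pi.single i κ + Pi.single k κ : Fin n → ℤ) =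
            Pi.single a κ + Pi.single b κ → i = a ∨ i = b := by
          intro i k hik heq
          by_contra! hne
          have := congrFun heq i
          simp only [Pi.add_apply, Pi.single_eq_same, Pi.single_eq_of_ne hik,
            Pi.single_eq_of_ne hne.1, Pi.single_eq_of_ne hne.2, add_zero] at this
          exact hZ.ne_zero this
        have h1 := key i k hik heq
        have h2 := key k i (Ne.symm hik) (by rw [add_comm, heq])
        grind
      have h1 := aux i k hik ((h i k hik).eq_of_add_eq (h j l hjl) hw)
      have h2 := aux j l hjl ((h j l hjl).eq_of_add_eq (h i k hik) (by rw [add_comm, hw]))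
      refine Submodule.mem_sup_left ?_
      have hs := Submodule.mem_span_singleton_self (R := ℂ) (minor Z a b a b)
      rcases h1 with ⟨rfl, rfl⟩ | ⟨rfl, rfl⟩ <;> rcases h2 with ⟨rfl, rfl⟩ | ⟨rfl, rfl⟩
      · exact hs
      · convert Submodule.neg_mem _ hs using 1
        simp only [minor]; ring
      · convert Submodule.neg_mem _ hs using 1
        simp only [minor]; ring
      · convert hs using 1
        simp only [minor]; ring
    · have hlt : WeightLT ((Pi.single a κ + Pi.single b κ) + (Pi.single a κ + Pi.single b κ))
          ((Pi.single i κ + Pi.single k κ) + (Pi.single j κ + Pi.single l κ)) :=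
        ⟨(h i k hik).add (h j l hjl), hw⟩
      exact Submodule.mem_sup_right (mem_weightSum hlt (hZ.minor_mem_weightSpace i k j l))
  · obtain ⟨M, hM, hMu⟩ := hZ.finite_entry
    refine ⟨M * M, hM.mul hM, fun u => ?_⟩
    rw [minor, map_sub, coverRep_mul, coverRep_mul]
    exact Submodule.sub_mem _ (Submodule.mul_mem_mul (hMu _ _ u) (hMu _ _ u))
      (Submodule.mul_mem_mul (hMu _ _ u) (hMu _ _ u))

theorem coverRep_minor (hZ : IsEquivariantMatrix Z g κ) (u : Matrix.unitaryGroup (Fin n) ℂ)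
    (a b : Fin n) : coverRep n u (minor Z a b a b) = fun x =>
      bil (Z x) (fun i => g u i a) (fun i => g u i a) *
        bil (Z x) (fun i => g u i b) (fun i => g u i b) -
      bil (Z x) (fun i => g u i a) (fun i => g u i b) *
        bil (Z x) (fun i => g u i a) (fun i => g u i b) := by
  rw [minor, map_sub, coverRep_mul, coverRep_mul, hZ.coverRep_entry, hZ.coverRep_entry,
    hZ.coverRep_entry, hZ.coverRep_entry]
  funext x
  simp only [Pi.sub_apply, Pi.mul_apply]
  rw [bil_comm (hZ.symm x) (fun i => g u i b) (fun i => g u i a)]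

end IsEquivariantMatrix

/-- A function on which `U(n)` acts by a power of the determinant. -/
theorem isHighestWeightFunction_of_character {h : LagCover n → ℂ} {κ : ℤ}
    (hh : ∀ (x : LagCover n) (u : Matrix.unitaryGroup (Fin n) ℂ), h (x.act u) =
      (u : Matrix (Fin n) (Fin n) ℂ).det ^ κ * h x) :
    IsHighestWeightFunction h fun _ => κ := by
  have hmem : ∀ u, coverRep n u h ∈ Submodule.span ℂ {h} := by
    intro u
    refine Submodule.mem_span_singleton.2 ⟨(u : Matrix (Fin n) (Fin n) ℂ).det ^ κ, ?_⟩
    funext x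
    exact (hh x u).symm
  refine ⟨⟨fun x => ?_, fun z => ?_⟩, fun u => Submodule.mem_sup_left (hmem u),
    ⟨_, Submodule.fg_span (Set.finite_singleton h), hmem⟩⟩
  · simp only [hh]
    have hc : Continuous fun u : Matrix.unitaryGroup (Fin n) ℂ =>
        (u : Matrix (Fin n) (Fin n) ℂ).det := continuous_subtype_val.matrix_det
    refine (hc.zpow₀ κ fun u => Or.inl ?_).mul continuous_const
    have := congrArg Matrix.det (Matrix.mem_unitaryGroup_iff.1 u.2)
    rw [Matrix.det_mul, Matrix.det_one] at this
    exact left_ne_zero_of_mul_eq_one this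
  · funext x
    change h (x.act (diagU z)) = _
    rw [hh]
    simp [diagU, torusChar, Finset.prod_zpow]

theorem isHighestWeightFunction_s : IsHighestWeightFunction (fun x : LagCover n => x.s) fun _ => 1 :=
  isHighestWeightFunction_of_character fun x u => by simp [LagCover.act]

theorem isHighestWeightFunction_inv_s :
    IsHighestWeightFunction (fun x : LagCover n => x.s⁻¹) fun _ => -1 :=
  isHighestWeightFunction_of_character fun x u => by simp [LagCover.act, mul_comm]

end Generators

/-! ### The three series of representations -/

section Series

variable {n : ℕ}

theorem containsExtraneous_of_isHighestWeightFunction (hn : 0 < n) {h : LagCover n → ℂ}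
    {m : Fin n → ℤ} (H : IsHighestWeightFunction h m) (h0 : h ≠ 0) (hm : Antitone m)
    (hsol : ∀ u, coverRep n u h ∈ globalSolutions n) : ContainsExtraneous n m :=
  ⟨orbitSpan h, H.hasSignature h0 hm,
    fun _ hf => isDeltaSolution_of_mem_globalSolutions (orbitSpan_le hsol hf),
    fun _ _ hf0 hR => hf0 (eq_zero_of_isRadonTransform_constOnFibres hn hR)⟩

/-- The base point of the double cover. -/
def basePoint (n : ℕ) : LagCover n where
  T := 1
  s := 1
  unitary := one_mem _
  symm := Matrix.transpose_one
  sq := by simp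

theorem partial_sum_single (i : Fin n) (κ : ℤ) (k : ℕ) :
    ∑ j with j.val < k, (Pi.single i κ : Fin n → ℤ) j = if i.val < k then κ else 0 := by
  rw [Finset.sum_filter]
  simp_rw [Pi.single_apply]
  rw [Finset.sum_eq_single i]
  · simp
  · intro j _ hj
    simp [hj]
  · simp

theorem weightLE_single {i a : Fin n} {κ : ℤ}
    (h : ∀ k : ℕ, (if i.val < k then κ else 0) ≤ if a.val < k then κ else 0) :
    WeightLE (Pi.single i κ) (Pi.single a κ : Fin n → ℤ) := by
  refine ⟨fun k => ?_, by simp⟩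
  rw [partial_sum_single, partial_sum_single]
  exact h k

theorem weightLE_single_add_single {i j a b : Fin n} {κ : ℤ}
    (h : ∀ k : ℕ, (if i.val < k then κ else 0) + (if j.val < k then κ else 0) ≤
      (if a.val < k then κ else 0) + if b.val < k then κ else 0) :
    WeightLE (Pi.single i κ + Pi.single j κ) (Pi.single a κ + Pi.single b κ : Fin n → ℤ) := by
  refine ⟨fun k => ?_, by simp [Finset.sum_add_distrib]⟩
  simp only [Pi.add_apply, Finset.sum_add_distrib, partial_sum_single]
  exact h k

theorem containsExtraneous_sigPos (hn : 2 ≤ n) {α β : ℕ} (hβα : β ≤ α) :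
    ContainsExtraneous n (sigPos n α β) := by
  set a : Fin n := ⟨0, by omega⟩ with ha
  set b : Fin n := ⟨1, by omega⟩ with hb
  have hab : a ≠ b := by simp [ha, hb]
  have hZ := isEquivariantMatrix_T (n := n)
  have H1 := hZ.isHighestWeightFunction_diag a fun i => weightLE_single fun k => by
    simp only [ha]; split_ifs <;> omega
  have H2 := hZ.isHighestWeightFunction_minor hab fun i k hik => weightLE_single_add_single fun l => by
    have : i.val ≠ k.val := fun h => hik (Fin.ext h)
    simp only [ha, hb]; split_ifs <;> omega
  -- The generator is `s T₁₁^(α-β) Δ^β`, with `Δ` the leading 2×2 minor.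
  have H := isHighestWeightFunction_s.mul ((H1.pow (α - β)).mul (H2.pow β))
  have hm : (fun _ => 1) + ((α - β) • (Pi.single a 1 + Pi.single a 1) +
      β • ((Pi.single a 1 + Pi.single b 1) + (Pi.single a 1 + Pi.single b 1))) =
      sigPos n α β := by
    funext i
    simp only [Pi.add_apply, Pi.smul_apply, Pi.single_apply, sigPos, ha, hb, Fin.ext_iff]
    split_ifs <;> simp only [nsmul_eq_mul] <;> push_cast [hβα] <;> omega
  rw [hm] at H
  refine containsExtraneous_of_isHighestWeightFunction (by omega) H (fun h => ?_) ?_ fun u => ?_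
  -- At `T = 1`, `s = 1` the generator has the value 1.
  · have := congrFun h (basePoint n)
    simp [basePoint, IsEquivariantMatrix.minor, hab, hab.symm] at this
  · intro i j hij
    have : i.val ≤ j.val := hij
    simp only [sigPos]
    split_ifs <;> omega
  · rw [coverRep_mul, coverRep_mul]
    have hs : coverRep n u (fun x : LagCover n => x.s) =
        (u : Matrix (Fin n) (Fin n) ℂ).det • fun x => x.s := rfl
    have hp : ∀ (f : LagCover n → ℂ) (k : ℕ), coverRep n u (f ^ k) = coverRep n u f ^ k :=
      fun _ _ => rfl
    rw [hs, hp, hp, hZ.coverRep_entry, hZ.coverRep_minor, smul_mul_assoc]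
    exact Submodule.smul_mem _ _ (s_mul_minor_mem_globalSolutions _ _ _ _)

theorem containsExtraneous_sigNeg (hn : 2 ≤ n) {γ δ : ℕ} (hγδ : γ ≤ δ) :
    ContainsExtraneous n (sigNeg n γ δ) := by
  -- For `T⁻¹` the weights are `-eᵢ`, the highest of which belongs to the last index.
  set a : Fin n := ⟨n - 1, by omega⟩ with ha
  set b : Fin n := ⟨n - 2, by omega⟩ with hb
  have hab : a ≠ b := by simp [ha, hb]; omega
  have hZ := isEquivariantMatrix_inv (n := n)
  have H1 := hZ.isHighestWeightFunction_diag a fun i => weightLE_single fun k => by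
    have := i.isLt
    simp only [ha]; split_ifs <;> omega
  have H2 := hZ.isHighestWeightFunction_minor hab fun i k hik => weightLE_single_add_single fun l => by
    have : i.val ≠ k.val := fun h => hik (Fin.ext h)
    have := i.isLt
    have := k.isLt
    simp only [ha, hb]; split_ifs <;> omega
  have H := isHighestWeightFunction_inv_s.mul ((H1.pow (δ - γ)).mul (H2.pow γ))
  have hm : (fun _ => -1) + ((δ - γ) • (Pi.single a (-1) + Pi.single a (-1)) +
      γ • ((Pi.single a (-1) + Pi.single b (-1)) + (Pi.single a (-1) + Pi.single b (-1)))) =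
      sigNeg n γ δ := by
    funext i
    have h1 : i.val = n - 1 ↔ i.val + 1 = n := by omega
    have h2 : i.val = n - 2 ↔ i.val + 2 = n := by omega
    simp only [Pi.add_apply, Pi.smul_apply, Pi.single_apply, sigNeg, ha, hb, Fin.ext_iff, h1, h2]
    split_ifs <;> simp only [nsmul_eq_mul] <;> push_cast [hγδ] <;> omega
  rw [hm] at H
  refine containsExtraneous_of_isHighestWeightFunction (by omega) H (fun h => ?_) ?_ fun u => ?_
  · have := congrFun h (basePoint n)
    simp [basePoint, IsEquivariantMatrix.minor, hab, hab.symm] at this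
  · intro i j hij
    have : i.val ≤ j.val := hij
    have := j.isLt
    simp only [sigNeg]
    split_ifs <;> omega
  · rw [coverRep_mul, coverRep_mul]
    have hs : coverRep n u (fun x : LagCover n => x.s⁻¹) =
        (u : Matrix (Fin n) (Fin n) ℂ).det⁻¹ • fun x => x.s⁻¹ := by
      funext x
      change ((u : Matrix (Fin n) (Fin n) ℂ).det * x.s)⁻¹ = _
      rw [mul_inv]
      rfl
    have hp : ∀ (f : LagCover n → ℂ) (k : ℕ), coverRep n u (f ^ k) = coverRep n u f ^ k :=
      fun _ _ => rfl
    rw [hs, hp, hp, hZ.coverRep_entry, hZ.coverRep_minor, smul_mul_assoc]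
    exact Submodule.smul_mem _ _ (inv_s_mul_minor_inv_mem_globalSolutions _ _ _ _)

theorem containsExtraneous_sigMixed (hn : 2 ≤ n) (α γ : ℕ) :
    ContainsExtraneous n (sigMixed n α γ) := by
  set a : Fin n := ⟨0, by omega⟩ with ha
  set b : Fin n := ⟨n - 1, by omega⟩ with hb
  have hZ := isEquivariantMatrix_T (n := n)
  have hY := isEquivariantMatrix_inv (n := n)
  have H1 := hZ.isHighestWeightFunction_diag a fun i => weightLE_single fun k => by
    simp only [ha]; split_ifs <;> omega
  have H2 := hY.isHighestWeightFunction_diag b fun i => weightLE_single fun k => by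
    have := i.isLt
    simp only [hb]; split_ifs <;> omega
  -- One factor of each type: the prefactors `s` and `s⁻¹` cancel.
  have H := (H1.pow α).mul (H2.pow γ)
  have hm : α • (Pi.single a 1 + Pi.single a 1) + γ • (Pi.single b (-1) + Pi.single b (-1)) =
      sigMixed n α γ := by
    funext i
    have h1 : i.val = n - 1 ↔ i.val + 1 = n := by omega
    simp only [Pi.add_apply, Pi.smul_apply, Pi.single_apply, sigMixed, ha, hb, Fin.ext_iff, h1]
    split_ifs <;> simp only [nsmul_eq_mul] <;> omega
  rw [hm] at H
  refine containsExtraneous_of_isHighestWeightFunction (by omega) H (fun h => ?_) ?_ fun u => ?_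
  · have := congrFun h (basePoint n)
    simp [basePoint] at this
  · intro i j hij
    have : i.val ≤ j.val := hij
    have := j.isLt
    simp only [sigMixed]
    split_ifs <;> omega
  · rw [coverRep_mul]
    have hp : ∀ (f : LagCover n → ℂ) (k : ℕ), coverRep n u (f ^ k) = coverRep n u f ^ k :=
      fun _ _ => rfl
    rw [hp, hp, hZ.coverRep_entry, hY.coverRep_entry]
    exact bil_pow_mul_bil_inv_pow_mem_globalSolutions _ _ _ _

end Series

end Extraneous

end

theorem mainTheorem7 (n : ℕ) (hn : 2 ≤ n) :
    (∀ f : Extraneous.LagCover n → ℂ,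
      Extraneous.IsCompSolution (Extraneous.constOnFibres f) ↔ Extraneous.IsDeltaSolution f) ∧
    (∀ α β : ℕ, β ≤ α → Extraneous.ContainsExtraneous n (Extraneous.sigPos n α β)) ∧
    (∀ α γ : ℕ, Extraneous.ContainsExtraneous n (Extraneous.sigMixed n α γ)) ∧
    (∀ γ δ : ℕ, γ ≤ δ → Extraneous.ContainsExtraneous n (Extraneous.sigNeg n γ δ)) :=
  ⟨fun _ => ⟨Extraneous.isDeltaSolution_of_isCompSolution,
      Extraneous.isCompSolution_of_isDeltaSolution⟩,
    fun _ _ h => Extraneous.containsExtraneous_sigPos hn h,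
    fun α γ => Extraneous.containsExtraneous_sigMixed hn α γ,
    fun _ _ h => Extraneous.containsExtraneous_sigNeg hn h⟩
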